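/- **Setting.** Fix an integer $d\ge 1$ and $T\in(0,\infty)$. For $t\in[0,T]$ let $\Omega^t=\{\omega\in C([t,T];\mathbb R^d):\omega(t)=0\}$, with canonical process $B^t_r(\omega)=\omega(r)$, natural filtration $\mathbf F^t=(\mathcal F^t_s)_{s\in[t,T]}$, $\mathcal F^t_s=\sigma(B^t_r:r\in[t,s])$, and let $\mathcal T^t$ be the set of $[t,T]$-valued $\mathbf F^t$-stopping times. The superscript $t=0$ is dropped. Write $\|\omega\|_{t,s}=\sup_{r\in[t,s]}|\omega(r)|$ and $O^s_\delta(\omega)=\{\omega'\in\Omega^t:\|\omega'-\omega\|_{t,s}<\delta\}$. For $t\le s$, $\omega\in\Omega^t$, $\omega'\in\Omega^s$, the concatenation $\omega\otimes_s\omega'\in\Omega^t$ equals $\omega(r)$ for $r\in[t,s)$ and $\omega(s)+\omega'(r)$ for $r\in[s,T]$; the truncation $\Pi^t_s:\Omega^t\to\Omega^s$ is $\Pi^t_s(\omega)(r)=\omega(r)-\omega(s)$. For a process $X$ on $\Omega$ and $(t,\omega)\in[0,T]\times\Omega$, set $X^{t,\omega}_r(\omega')=X_r(\omega\otimes_t\omega')$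 for $r\in[t,T]$, $\omega'\in\Omega^t$. For a probability $\mathbb P$ on $(\Omega^t,\mathcal F^t_T)$ and $s\in[t,T]$, the shifted probability $\mathbb P^{s,\omega}$ on $(\Omega^s,\mathcal F^s_T)$ is $\mathbb P^{s,\omega}(A)=\mathbb P^s_\omega(\omega\otimes_sA)$, where $(\mathbb P^s_\omega)_\omega$ is the regular conditional probability distribution of $\mathbb P$ given $\mathcal F^t_s$, with $\mathbb P^s_\omega(\omega\otimes_s\Omega^s)=1$. A modulus of continuity function is a non-decreasing $\rho:[0,\infty)\to[0,\infty)$ with $\lim_{x\to0+}\rho(x)=0$. Let $\mathfrak M$ be the set of those for which there are $C>0$ and $0<p_1\le p_2$ with $\rho(x)\le C(x^{p_1}\vee x^{p_2})$ for all $x\ge0$. Let $\mathfrak S$ be the set of pairs $(Y,\wp)$ such that (i) $Y$ is a real-valued process on $[0,T]\times\Omega$, bounded by some $M_Y>0$, and for some $\rho_Y\in\mathfrak M$ $$|Y_{t_1}(\omega_1)-Y_{t_2}(\omega_2)|\le\rho_Y\big(|t_1-t_2|+\|\omega_1(\cdot\wedge t_1)-\omega_2(\cdot\wedge t_2)\|_{0,T}\big)\quad\text{for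 all }(t_i,\omega_i)\in[0,T]\times\Omega;$$ (ii) $\wp\in\mathcal T$ and, for some $\kappa_\wp>0$, $|\wp(\omega)-\wp(\omega')|\le\kappa_\wp\|\omega-\omega'\|_{0,T}$ for all $\omega,\omega'\in\Omega$. For such a pair put $\widehat Y_t=Y_{\wp\wedge t}$. For each $t\in[0,T]$ let $\mathcal P_t$ be a non-empty set of probabilities on $(\Omega^t,\mathcal F^t_T)$. Assume: (P2) For every $\rho\in\mathfrak M$ there is $\widehat\rho\in\mathfrak M$ such that for all $t\in[0,T)$ and $\delta>0$ $$\sup_{(\mathbb P,\zeta)\in\mathcal P_t\times\mathcal T^t}\mathbb E_{\mathbb P}\Big[\rho\Big(\delta+\sup_{r\in[\zeta,(\zeta+\delta)\wedge T]}|B^t_r-B^t_\zeta|\Big)\Big]\le\widehat\rho(\delta).\tag{1}$$ (P3) For all $0\le t<s\le T$ and $\mathbb P\in\mathcal P_t$ there are an extension $(\Omega^t,\mathcal F',\mathbb P')$ of $(\Omega^t,\mathcal F^t_T,\mathbb P)$ and $\Omega'\in\mathcal F'$ with $\mathbb P'(\Omega')=1$ such that $\mathbb P^{s,\widetilde\omega}\in\mathcal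 P_s$ for all $\widetilde\omega\in\Omega'$. (P4) For every $(Y,\wp)\in\mathfrak S$ there is a modulus of continuity function $\overline\rho_Y$ such that for all $0\le t<s\le T$, $\omega\in\Omega$, $\mathbb P\in\mathcal P_t$, all rational $\delta>0$ and $\lambda\in\mathbb N$, every $\mathcal F^t_s$-measurable partition $\{\mathcal A_j\}_{j=0}^\lambda$ of $\Omega^t$ (cells may be empty) such that for $j=1,\dots,\lambda$ one has $\mathcal A_j\subset O^s_{\delta_j}(\widetilde\omega_j)$ for some rational $\delta_j\in(0,\delta]$ and $\widetilde\omega_j\in\Omega^t$, and all $\mathbb P_1,\dots,\mathbb P_\lambda\in\mathcal P_s$, there is $\widehat{\mathbb P}\in\mathcal P_t$ with: $\widehat{\mathbb P}(A\cap\mathcal A_0)=\mathbb P(A\cap\mathcal A_0)$ for all $A\in\mathcal F^t_T$; and for $j=1,\dots,\lambda$ and $A\in\mathcal F^t_s$, $\widehat{\mathbb P}(A\cap\mathcal A_j)=\mathbb P(A\cap\mathcal A_j)$ and $$\mathbb E_{\widehat{\mathbb P}}\big[\mathbf 1_{A\cap\mathcal A_j}\widehat Y^{t,\omega}_{\gamma(\Pi^t_s)}\big]\ge\mathbb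 E_{\mathbb P}\Big[\mathbf 1_{\{\widetilde\omega\in A\cap\mathcal A_j\}}\Big(\mathbb E_{\mathbb P_j}\big[\widehat Y^{s,\omega\otimes_t\widetilde\omega}_\gamma\big]-\overline\rho_Y(\delta)\Big)\Big]\quad\text{for all }\gamma\in\mathcal T^s.$$ **Proposition.** Let $(Y,\wp)\in\mathfrak S$, with $M_Y,\rho_Y,\kappa_\wp$ as in its definition, and let $$Z_t(\omega)=\sup_{(\mathbb P,\gamma)\in\mathcal P_t\times\mathcal T^t}\mathbb E_{\mathbb P}\big[\widehat Y^{t,\omega}_\gamma\big],\qquad(t,\omega)\in[0,T]\times\Omega.$$ Then for all $(t,\omega)\in[0,T]\times\Omega$ and $\nu\in\mathcal T^t$ the random variables below are integrable and $$Z_t(\omega)=\sup_{(\mathbb P,\gamma)\in\mathcal P_t\times\mathcal T^t}\mathbb E_{\mathbb P}\Big[\mathbf 1_{\{\gamma<\nu\}}\widehat Y^{t,\omega}_\gamma+\mathbf 1_{\{\gamma\ge\nu\}}Z^{t,\omega}_\nu\Big].$$ Consequently, $Z$ is an $\mathbf F$-adapted process bounded by $M_Y$ all of whose paths are continuous. More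 precisely, let $\widehat\rho_Y,\widehat{\widehat\rho}_Y,\widehat\varrho\in\mathfrak M$ be any functions such that (1) holds for the pairs $(\rho,\widehat\rho)=(\rho_Y,\widehat\rho_Y)$, $(\widehat\rho_Y,\widehat{\widehat\rho}_Y)$ and $(\varrho,\widehat\varrho)$, where $\varrho(x)=x$, and let $C_\varrho>0$, $0<q_1\le q_2$ be such that $\widehat\varrho(x)\le C_\varrho(x^{q_1}\vee x^{q_2})$ for all $x\ge0$. Then for all $\omega\in\Omega$ and $0\le t\le s\le T$ $$|Z_t(\omega)-Z_s(\omega)|\le2C_\varrho M_Y\Big((s-t)^{\frac{q_1}2}\vee(s-t)^{q_2-\frac{q_1}2}\Big)+\widehat\rho_Y(s-t)+2\Big(\widehat\rho_Y(\delta_{t,s}(\omega))\vee\widehat{\widehat\rho}_Y(\delta_{t,s}(\omega))\Big),$$ where $\delta_{t,s}(\omega)=(1+\kappa_\wp)\Big((s-t)^{\frac{q_1}2}+\sup_{t\le r<r'\le s}|\omega(r')-\omega(r)|\Big)$, with the convention $\sup\emptyset=0$. -/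

import Mathlib

open MeasureTheory ProbabilityTheory Filter Topology

noncomputable section

namespace SnellEnvelope

/-- The Euclidean space `ℝ^d`. -/
abbrev E (d : ℕ) : Type := EuclideanSpace ℝ (Fin d)

/-- The time interval `[0, T]`. -/
abbrev Time (T : ℝ) : Type := Set.Icc (0 : ℝ) T

/-- The initial time `0`, for a positive horizon `T`. -/
def Time.zero (T : ℝ) [hT : Fact (0 < T)] : Time T := ⟨0, le_rfl, hT.out.le⟩

theorem Time.zero_le {T : ℝ} [Fact (0 < T)] (t : Time T) : Time.zero T ≤ t := t.2.1

/-- The canonical space `Ω^t` of continuous paths `ω : [t, T] → ℝ^d` with `ω(t) = 0`. -/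
def PathSpace (d : ℕ) {T : ℝ} (t : Time T) : Type :=
  {ω : C(Set.Icc (t : ℝ) T, E d) // ω ⟨t, le_rfl, t.2.2⟩ = 0}

/-- `Ω = Ω^0`. -/
abbrev Omega (d : ℕ) (T : ℝ) [Fact (0 < T)] : Type := PathSpace d (Time.zero T)

/-- The position `ω(r)` of a path of `Ω^t` at time `r ∈ [t, T]`. For `r < t` this is `ω(t) = 0`. -/
def PathSpace.eval {d : ℕ} {T : ℝ} {t : Time T} (ω : PathSpace d t) (r : Time T) : E d :=
  ω.1 (Set.projIcc (t : ℝ) T t.2.2 r)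

instance {d : ℕ} {T : ℝ} {t : Time T} : CoeFun (PathSpace d t) (fun _ => Time T → E d) :=
  ⟨PathSpace.eval⟩

theorem eval_of_le {d : ℕ} {T : ℝ} {t : Time T} (ω : PathSpace d t) {r : Time T} (h : r ≤ t) :
    ω r = 0 := by
  have h' : (r : ℝ) ≤ (t : ℝ) := h
  unfold PathSpace.eval
  rw [Set.projIcc_of_le_left t.2.2 h']
  exact ω.2

theorem continuous_eval_path {d : ℕ} {T : ℝ} {t : Time T} (ω : PathSpace d t) :
    Continuous fun r : Time T => ω r :=
  ω.1.continuous.comp (continuous_projIcc.comp continuous_subtype_val)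

/-- A time of `[t, T]`, seen as a time of `[0, T]`. -/
def Time.ofIcc {T : ℝ} {t : Time T} (r : Set.Icc (t : ℝ) T) : Time T :=
  ⟨r, t.2.1.trans r.2.1, r.2.2⟩

theorem Time.continuous_ofIcc {T : ℝ} {t : Time T} :
    Continuous (Time.ofIcc : Set.Icc (t : ℝ) T → Time T) :=
  continuous_subtype_val.subtype_mk _

/-- The concatenation `ω ⊗_s ω'` of `ω ∈ Ω^t` and `ω' ∈ Ω^s`, for `t ≤ s`: the path equal to `ω(r)`
for `r ∈ [t, s)` and to `ω(s) + ω'(r)` for `r ∈ [s, T]`. -/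
def concat {d : ℕ} {T : ℝ} {t s : Time T} (h : t ≤ s) (ω : PathSpace d t) (ω' : PathSpace d s) :
    PathSpace d t :=
  ⟨⟨fun r => if Time.ofIcc r < s then ω (Time.ofIcc r)
      else ω s + ω' (Time.ofIcc r), by
      have key : (fun r : Set.Icc (t : ℝ) T => if Time.ofIcc r < s then ω (Time.ofIcc r)
          else ω s + ω' (Time.ofIcc r))
          = fun r => ω (min (Time.ofIcc r) s) + ω' (Time.ofIcc r) := by
        funext r
        split_ifs with hr
        · rw [min_eq_left hr.le, eval_of_le ω' hr.le, add_zero]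
        · rw [min_eq_right (not_lt.1 hr)]
      rw [key]
      exact ((continuous_eval_path ω).comp (Time.continuous_ofIcc.min continuous_const)).add
        ((continuous_eval_path ω').comp Time.continuous_ofIcc)⟩, by
    change (if Time.ofIcc (⟨t, le_rfl, t.2.2⟩ : Set.Icc (t : ℝ) T) < s then _ else _) = (0 : E d)
    have h0 : Time.ofIcc (⟨t, le_rfl, t.2.2⟩ : Set.Icc (t : ℝ) T) = t := rfl
    rw [h0]
    split_ifs with hr
    · exact eval_of_le ω le_rfl
    · have hs : s = t := le_antisymm (not_lt.1 hr) h
      subst hs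
      rw [eval_of_le ω le_rfl, eval_of_le ω' le_rfl, add_zero]⟩

/-- The truncation `Π^t_s : Ω^t → Ω^s`, `(Π^t_s ω)(r) = ω(r) - ω(s)` for `r ∈ [s, T]`. -/
def trunc {d : ℕ} {T : ℝ} {t : Time T} (s : Time T) (ω : PathSpace d t) : PathSpace d s :=
  ⟨⟨fun r => ω (Time.ofIcc r) - ω s,
      ((continuous_eval_path ω).comp Time.continuous_ofIcc).sub continuous_const⟩, by
    change ω (Time.ofIcc (⟨s, le_rfl, s.2.2⟩ : Set.Icc (s : ℝ) T)) - ω s = 0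
    exact sub_self _⟩

/-- The `σ`-algebra `ℱ^t_T`, generated by the canonical process `B^t_r(ω) = ω(r)`. -/
instance instMeasurableSpacePathSpace {d : ℕ} {T : ℝ} {t : Time T} :
    MeasurableSpace (PathSpace d t) :=
  ⨆ r : Time T, MeasurableSpace.comap (fun ω : PathSpace d t => ω r) inferInstance

theorem measurable_eval {d : ℕ} {T : ℝ} {t : Time T} (r : Time T) :
    Measurable fun ω : PathSpace d t => ω r :=
  measurable_iff_comap_le.2
    (le_iSup (fun r : Time T => MeasurableSpace.comap (fun ω : PathSpace d t => ω r) _) r)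

/-- The natural filtration `𝐅^t = (ℱ^t_s)_s` of the canonical process on `Ω^t`. It is indexed by all
`s ∈ [0, T]`; since `B^t_r = 0` for `r ≤ t`, `ℱ^t_s` is the `σ`-algebra generated by `B^t_r`,
`r ∈ [t, s]`, for `s ∈ [t, T]`, and it is trivial for `s < t`. -/
def filt (d : ℕ) {T : ℝ} (t : Time T) :
    Filtration (Time T) (instMeasurableSpacePathSpace (d := d) (t := t)) :=
  Filtration.natural (fun (r : Time T) (ω : PathSpace d t) => ω r)
    (fun r => (measurable_eval r).stronglyMeasurable)

/-- The set `𝒯^t` of `𝐅^t`-stopping times, with values in `[t, T]`. -/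
def stoppingTimes (d : ℕ) {T : ℝ} (t : Time T) : Set (PathSpace d t → Time T) :=
  {τ | (∀ ω, t ≤ τ ω) ∧ IsStoppingTime (filt d t) fun ω => (τ ω : WithTop (Time T))}

/-- `‖ω - ω'‖_{t,s} = sup_{r ∈ [t, s]} |ω(r) - ω'(r)|` for paths `ω, ω' ∈ Ω^t`. -/
def supDist {d : ℕ} {T : ℝ} {t : Time T} (s : Time T) (ω ω' : PathSpace d t) : ℝ :=
  ⨆ r : {r : Time T // t ≤ r ∧ r ≤ s}, ‖ω r - ω' r‖

/-- The set `O^s_δ(ω)` of the paths `ω' ∈ Ω^t` with `‖ω' - ω‖_{t,s} < δ`. -/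
def pathBall {d : ℕ} {T : ℝ} {t : Time T} (s : Time T) (δ : ℝ) (ω : PathSpace d t) :
    Set (PathSpace d t) :=
  {ω' | supDist s ω' ω < δ}

theorem measurable_of_eval {d : ℕ} {T : ℝ} {t : Time T} {α : Type*} [MeasurableSpace α]
    {f : α → PathSpace d t} (hf : ∀ r : Time T, Measurable fun a => f a r) : Measurable f := by
  rw [measurable_iff_comap_le, instMeasurableSpacePathSpace, MeasurableSpace.comap_iSup]
  refine iSup_le fun r => ?_
  rw [MeasurableSpace.comap_comp]
  exact (hf r).comap_le

theorem measurable_trunc {d : ℕ} {T : ℝ} {t : Time T} (s : Time T) :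
    Measurable (trunc s : PathSpace d t → PathSpace d s) :=
  measurable_of_eval fun r =>
    (measurable_eval (Time.ofIcc (Set.projIcc (s : ℝ) T s.2.2 r))).sub (measurable_eval s)

/-- `(Ω^t, ℱ^t_T)` is a standard Borel space: `ℱ^t_T` is the Borel `σ`-algebra of the uniform norm,
for which `Ω^t` is a closed subset of the Polish space `C([t, T]; ℝ^d)`. -/
instance instStandardBorelSpacePathSpace {d : ℕ} {T : ℝ} {t : Time T} :
    StandardBorelSpace (PathSpace d t) := by
  let a : Set.Icc (t : ℝ) T := ⟨t, le_rfl, t.2.2⟩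
  let τ : TopologicalSpace (PathSpace d t) :=
    TopologicalSpace.induced Subtype.val inferInstance
  have hclosed : IsClosed {ω : C(Set.Icc (t : ℝ) T, E d) | ω a = 0} :=
    isClosed_eq (ContinuousEvalConst.continuous_eval_const a) continuous_const
  have hpol : PolishSpace (PathSpace d t) := hclosed.polishSpace
  have : Nonempty (Set.Icc (t : ℝ) T) := ⟨a⟩
  let J : PathSpace d t → (ℕ → E d) :=
    fun ω n => ω.1 (TopologicalSpace.denseSeq (Set.Icc (t : ℝ) T) n)
  have hJc : Continuous J := continuous_pi fun n =>
    (ContinuousEvalConst.continuous_eval_const _).comp continuous_subtype_val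
  have hJi : Function.Injective J := by
    intro ω ω' h
    refine Subtype.ext (DFunLike.coe_injective ?_)
    refine Continuous.ext_on (TopologicalSpace.denseRange_denseSeq (Set.Icc (t : ℝ) T))
      ω.1.continuous ω'.1.continuous ?_
    rintro _ ⟨n, rfl⟩
    exact congrFun h n
  refine ⟨⟨τ, ⟨?_⟩, hpol⟩⟩
  apply le_antisymm
  · refine iSup_le fun r => ?_
    have hc : Continuous fun ω : PathSpace d t => ω r :=
      (ContinuousEvalConst.continuous_eval_const _).comp continuous_subtype_val
    let _ : MeasurableSpace (PathSpace d t) := borel (PathSpace d t)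
    have : BorelSpace (PathSpace d t) := ⟨rfl⟩
    exact hc.measurable.comap_le
  · have hJm : Measurable J := measurable_pi_lambda _ fun n => by
      have h := measurable_eval (d := d) (t := t)
        (Time.ofIcc (TopologicalSpace.denseSeq (Set.Icc (t : ℝ) T) n))
      have e : (fun ω : PathSpace d t => J ω n) = fun ω : PathSpace d t =>
          ω (Time.ofIcc (TopologicalSpace.denseSeq (Set.Icc (t : ℝ) T) n)) := by
        funext ω
        change _ = ω.1 (Set.projIcc (t : ℝ) T t.2.2 _)
        have e2 : ((Time.ofIcc (TopologicalSpace.denseSeq (Set.Icc (t : ℝ) T) n) : Time T) : ℝ)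
          = (TopologicalSpace.denseSeq (Set.Icc (t : ℝ) T) n : ℝ) := rfl
        rw [e2, Set.projIcc_val]
      rw [e]
      exact h
    have hle : borel (PathSpace d t) = MeasurableSpace.comap J MeasurableSpace.pi := by
      let _ : MeasurableSpace (PathSpace d t) := borel (PathSpace d t)
      have : BorelSpace (PathSpace d t) := ⟨rfl⟩
      exact (hJc.measurableEmbedding hJi).comap_eq.symm
    rw [hle]
    exact hJm.comap_le

/-- The shifted probability `ℙ^{s,ω}` on `Ω^s`: the regular conditional probability distribution of
`ℙ` given `ℱ^t_s` at `ω` is a probability on `Ω^t` carried by `ω ⊗_s Ω^s`, and `ℙ^{s,ω}(A)` is the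
mass it gives to `ω ⊗_s A`, that is, to `(Π^t_s)⁻¹(A)`. -/
def shiftedProb {d : ℕ} {T : ℝ} {t : Time T} (P : ProbabilityMeasure (PathSpace d t)) (s : Time T)
    (ω : PathSpace d t) : ProbabilityMeasure (PathSpace d s) :=
  ⟨(condExpKernel (P : Measure (PathSpace d t)) (filt d t s) ω).map (trunc s),
    Measure.isProbabilityMeasure_map (measurable_trunc s).aemeasurable⟩

/-- Modulus of continuity functions on `[0, ∞)`. -/
def IsModulus (ρ : ℝ → ℝ) : Prop :=
  (∀ x, 0 ≤ x → 0 ≤ ρ x) ∧ MonotoneOn ρ (Set.Ici 0) ∧ Tendsto ρ (𝓝[>] 0) (𝓝 0)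

/-- The bound `ρ(x) ≤ C (x^p ∨ x^q)` for all `x ≥ 0`. -/
def PowerBound (ρ : ℝ → ℝ) (C p q : ℝ) : Prop :=
  ∀ x : ℝ, 0 ≤ x → ρ x ≤ C * max (x ^ p) (x ^ q)

/-- The class `𝔐` of modulus of continuity functions with a power bound. -/
def modulusClass : Set (ℝ → ℝ) :=
  {ρ | IsModulus ρ ∧ ∃ C p q : ℝ, 0 < C ∧ 0 < p ∧ p ≤ q ∧ PowerBound ρ C p q}

/-- The distance `𝐝_∞((t₁, ω₁), (t₂, ω₂)) = |t₁ - t₂| + ‖ω₁(· ∧ t₁) - ω₂(· ∧ t₂)‖_{0,T}`. -/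
def dInf {d : ℕ} {T : ℝ} [Fact (0 < T)] (t₁ : Time T) (ω₁ : Omega d T) (t₂ : Time T)
    (ω₂ : Omega d T) : ℝ :=
  |(t₁ : ℝ) - t₂| + ⨆ r : Time T, ‖ω₁ (min r t₁) - ω₂ (min r t₂)‖

/-- The process `Y` is bounded by `M` and uniformly continuous on `[0, T] × Ω` with respect to
`ρ ∈ 𝔐`, and `wp` is a stopping time that is Lipschitz continuous with coefficient `κ`. -/
structure IsPayoffPair {d : ℕ} {T : ℝ} [Fact (0 < T)] (Y : Time T → Omega d T → ℝ)
    (wp : Omega d T → Time T) (M : ℝ) (ρ : ℝ → ℝ) (κ : ℝ) : Prop where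
  bound_pos : 0 < M
  bound : ∀ t ω, |Y t ω| ≤ M
  modulus_mem : ρ ∈ modulusClass
  unifCont : ∀ t₁ t₂ ω₁ ω₂, |Y t₁ ω₁ - Y t₂ ω₂| ≤ ρ (dInf t₁ ω₁ t₂ ω₂)
  stopping : wp ∈ stoppingTimes d (Time.zero T)
  lipschitz_pos : 0 < κ
  lipschitz : ∀ ω ω', |(wp ω : ℝ) - wp ω'| ≤ κ * ⨆ r : Time T, ‖ω r - ω' r‖

/-- The class `𝔖` of pairs `(Y, wp)`. -/
def payoffClass (d : ℕ) (T : ℝ) [Fact (0 < T)] :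
    Set ((Time T → Omega d T → ℝ) × (Omega d T → Time T)) :=
  {p | ∃ M ρ κ, IsPayoffPair p.1 p.2 M ρ κ}

/-- The process `Ŷ_t = Y_{wp ∧ t}`. -/
def stopAt {d : ℕ} {T : ℝ} [Fact (0 < T)] (Y : Time T → Omega d T → ℝ) (wp : Omega d T → Time T) :
    Time T → Omega d T → ℝ :=
  fun t ω => Y (min (wp ω) t) ω

/-- For a process `X` on `Ω`, the shifted process `X^{t,ω}_r(ω') = X_r(ω ⊗_t ω')` on `Ω^t`. -/
def shift {d : ℕ} {T : ℝ} [Fact (0 < T)] (X : Time T → Omega d T → ℝ) (t : Time T)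
    (ω : Omega d T) : Time T → PathSpace d t → ℝ :=
  fun r ω' => X r (concat (Time.zero_le t) ω ω')

/-- `sup_{r ∈ [u, (u + δ) ∧ T]} |ω(r) - ω(u)|`. -/
def oscAfter {d : ℕ} {T : ℝ} {t : Time T} (u : Time T) (δ : ℝ) (ω : PathSpace d t) : ℝ :=
  ⨆ r : {r : Time T // u ≤ r ∧ (r : ℝ) ≤ u + δ}, ‖ω r - ω u‖

/-- `sup_{t ≤ r < r' ≤ s} |ω(r') - ω(r)|`. -/
def oscOn {d : ℕ} {T : ℝ} [Fact (0 < T)] (t s : Time T) (ω : Omega d T) : ℝ :=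
  ⨆ p : {p : Time T × Time T // t ≤ p.1 ∧ p.1 < p.2 ∧ p.2 ≤ s}, ‖ω p.1.2 - ω p.1.1‖

/-- For all `t ∈ [0, T)` and `δ > 0`, the supremum over `(ℙ, ζ) ∈ 𝒫_t × 𝒯^t` of
`𝔼_ℙ[ρ(δ + sup_{r ∈ [ζ, (ζ + δ) ∧ T]} |B^t_r - B^t_ζ|)]` is at most `ρ'(δ)`. -/
def MoveBound {d : ℕ} {T : ℝ} (PP : ∀ t : Time T, Set (ProbabilityMeasure (PathSpace d t)))
    (ρ ρ' : ℝ → ℝ) : Prop :=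
  ∀ t : Time T, (t : ℝ) < T → ∀ δ : ℝ, 0 < δ → ∀ P ∈ PP t, ∀ ζ ∈ stoppingTimes d t,
    ∫⁻ ω, ENNReal.ofReal (ρ (δ + oscAfter (ζ ω) δ ω)) ∂(P : Measure (PathSpace d t))
      ≤ ENNReal.ofReal (ρ' δ)

/-- Every `ρ ∈ 𝔐` admits a bound `ρ' ∈ 𝔐` for the expected modulus of the increments. -/
def HasMoveBounds {d : ℕ} {T : ℝ}
    (PP : ∀ t : Time T, Set (ProbabilityMeasure (PathSpace d t))) : Prop :=
  ∀ ρ ∈ modulusClass, ∃ ρ' ∈ modulusClass, MoveBound PP ρ ρ'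

/-- For some extension `(α, m', μ')` of the probability space `(α, m, μ)`, that is, `m ≤ m'` and `μ'`
restricts to `μ` on `m`, there is `S ∈ m'` with `μ'(S) = 1` on which the property `p` holds. -/
def HoldsOnExtension {α : Type*} (m : MeasurableSpace α) (μ : @Measure α m) (p : α → Prop) : Prop :=
  ∃ (m' : MeasurableSpace α) (hm : m ≤ m') (μ' : @Measure α m') (S : Set α),
    @Eq (@Measure α m) (μ'.trim hm) μ ∧ MeasurableSet[m'] S ∧ μ' S = 1 ∧ ∀ ω ∈ S, p ω

/-- Stability under shifts, for every `P ∈ 𝒫_t` and `t < s`: on a set of full probability of some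
extension of `(Ω^t, ℱ^t_T, P)`, the shifted probabilities `P^{s,ω}` belong to `𝒫_s`. -/
def ShiftInvariant {d : ℕ} {T : ℝ}
    (PP : ∀ t : Time T, Set (ProbabilityMeasure (PathSpace d t))) : Prop :=
  ∀ t s : Time T, t < s → ∀ P ∈ PP t,
    HoldsOnExtension instMeasurableSpacePathSpace (P : Measure (PathSpace d t))
      fun ω => shiftedProb P s ω ∈ PP s

/-- The weak stability under pasting. The cells of the partition are `A 0` and
`A j.succ`, `j : Fin lam`. -/
def WeaklyStableUnderPasting {d : ℕ} {T : ℝ} [Fact (0 < T)]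
    (PP : ∀ t : Time T, Set (ProbabilityMeasure (PathSpace d t))) : Prop :=
  ∀ (Y : Time T → Omega d T → ℝ) (wp : Omega d T → Time T), (Y, wp) ∈ payoffClass d T →
    ∃ ρbar : ℝ → ℝ, IsModulus ρbar ∧
      ∀ (t s : Time T), t < s → ∀ ω : Omega d T, ∀ P ∈ PP t, ∀ δ : ℚ, 0 < δ →
        ∀ (lam : ℕ) (A : Fin (lam + 1) → Set (PathSpace d t)),
          (∀ j, MeasurableSet[filt d t s] (A j)) →
          Pairwise (fun i j => Disjoint (A i) (A j)) →
          (⋃ j, A j) = Set.univ →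
          (∀ j : Fin lam, ∃ δj : ℚ, 0 < δj ∧ δj ≤ δ ∧
            ∃ ωj : PathSpace d t, A j.succ ⊆ pathBall s (δj : ℝ) ωj) →
          ∀ Pj : Fin lam → ProbabilityMeasure (PathSpace d s), (∀ j, Pj j ∈ PP s) →
            ∃ Phat ∈ PP t,
              (∀ B : Set (PathSpace d t), MeasurableSet B →
                (Phat : Measure (PathSpace d t)) (B ∩ A 0)
                  = (P : Measure (PathSpace d t)) (B ∩ A 0)) ∧
              ∀ (j : Fin lam) (B : Set (PathSpace d t)), MeasurableSet[filt d t s] B →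
                (Phat : Measure (PathSpace d t)) (B ∩ A j.succ)
                  = (P : Measure (PathSpace d t)) (B ∩ A j.succ) ∧
                ∀ γ ∈ stoppingTimes d s,
                  ∫ ω' in B ∩ A j.succ,
                      ((∫ ω'', shift (stopAt Y wp) s (concat (Time.zero_le t) ω ω') (γ ω'') ω''
                        ∂(Pj j : Measure (PathSpace d s))) - ρbar (δ : ℝ))
                      ∂(P : Measure (PathSpace d t))
                    ≤ ∫ ω' in B ∩ A j.succ, shift (stopAt Y wp) t ω (γ (trunc s ω')) ω'
                      ∂(Phat : Measure (PathSpace d t))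

/-- The Snell envelope `Z_t(ω) = sup_{(ℙ, γ) ∈ 𝒫_t × 𝒯^t} 𝔼_ℙ[X^{t,ω}_γ]` of a process `X`. -/
def snell {d : ℕ} {T : ℝ} [Fact (0 < T)]
    (PP : ∀ t : Time T, Set (ProbabilityMeasure (PathSpace d t))) (X : Time T → Omega d T → ℝ)
    (t : Time T) (ω : Omega d T) : ℝ :=
  sSup {x : ℝ | ∃ P ∈ PP t, ∃ γ ∈ stoppingTimes d t,
    x = ∫ ω', shift X t ω (γ ω') ω' ∂(P : Measure (PathSpace d t))}

/-- The payoff `1_{γ < ν} X^{t,ω}_γ + 1_{γ ≥ ν} Z^{t,ω}_ν` on `Ω^t`. -/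
def dppPayoff {d : ℕ} {T : ℝ} [Fact (0 < T)] (X Z : Time T → Omega d T → ℝ) (t : Time T)
    (ω : Omega d T) (γ ν : PathSpace d t → Time T) (ω' : PathSpace d t) : ℝ :=
  if γ ω' < ν ω' then shift X t ω (γ ω') ω' else shift Z t ω (ν ω') ω'

/-- `δ_{t,s}(ω) = (1 + κ) ((s - t)^{q/2} + sup_{t ≤ r < r' ≤ s} |ω(r') - ω(r)|)`. -/
def deltaTS {d : ℕ} {T : ℝ} [Fact (0 < T)] (κ q : ℝ) (t s : Time T) (ω : Omega d T) : ℝ :=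
  (1 + κ) * (((s : ℝ) - t) ^ (q / 2) + oscOn t s ω)

end SnellEnvelope

end

open SnellEnvelope

noncomputable section

namespace SnellEnvelope

variable {d : ℕ} {T : ℝ}

/-! ### Paths -/

/-! The filtration is handled pathwise: `filt d t s` is pulled back by `stopped s`, so an event of
time `s` is a measurable set depending only on the path up to `s`, and stopping times are tested in
the same way.

Regularity in the path. Two payoffs along `ω₁ ⊗_s ω'` and `ω₂ ⊗_s ω'` can differ only through the
distance of `ω₁` and `ω₂` up to `s` and through the movement of `ω'` after one stopping time `ζ`,
over a length controlled by the Lipschitz constant of `wp` (`abs_shift_sub_shift_le`). Assumption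
(P2) bounds the expectation of that movement uniformly in the probability and the stopping time, so
the expected payoffs are equicontinuous in the starting path and `Z_s` is continuous on `Ω`.

Two one-sided inequalities at a fixed time `s` follow. Conditioning, with (P3): on an event of
`ℱ^t_s` where `γ ≥ s`, the expected payoff is at most that of `Z_s` (`setIntegral_shift_le`).
Pasting, with (P4): on such an event `Z_s` is attained up to `ε` by changing the probability and the
stopping time on that event only (`exists_paste`). Because nothing changes outside the event,
pasting can be iterated over finitely many disjoint events carrying different times
(`setIntegral_add_sum_le`).

Regularity in time needs only deterministic times. The inequalities give `𝔼[Z_s] ≤ Z_t ≤ sup 𝔼[Z_s]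
+ ρ₁(s - t)`. The deviation of `Z_s` along a random continuation from its value along `ω` is at most
`ρ₁(δ_{t,s}(ω))` when the continuation moves by at most `(s - t)^{q₁/2}`, and the opposite event has
small probability by Markov's inequality.

Continuous paths make `Z` jointly measurable, and permit approximating a random time `ν` from above
by grid-valued times. On a grid cell `ν` is replaced by a fixed time, the fixed-time inequalities
apply, and dominated convergence gives both halves of the dynamic programming principle
(`integral_dppPayoff_le`, `integral_shift_le_dppPayoff`). -/

theorem PathSpace.ext {t : Time T} {ω ω' : PathSpace d t} (h : ∀ r : Time T, ω r = ω' r) :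
    ω = ω' := by
  refine Subtype.ext (ContinuousMap.ext fun r => ?_)
  have := h (Time.ofIcc r)
  unfold PathSpace.eval at this
  have e : Set.projIcc (t : ℝ) T t.2.2 ((Time.ofIcc r : Time T) : ℝ) = r :=
    Set.projIcc_val t.2.2 r
  rwa [e] at this

theorem ofIcc_projIcc {t : Time T} (r : Time T) :
    Time.ofIcc (Set.projIcc (t : ℝ) T t.2.2 r) = max t r := by
  apply Subtype.ext
  change max (t : ℝ) (min T r) = _
  rw [min_eq_right r.2.2]
  exact (Monotone.map_max (f := (Subtype.val : Time T → ℝ)) (fun _ _ h => h)).symm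

theorem eval_max {t : Time T} (ω : PathSpace d t) (r : Time T) : ω (max t r) = ω r := by
  rcases le_total t r with h | h
  · rw [max_eq_right h]
  · rw [max_eq_left h, eval_of_le ω h, eval_of_le ω le_rfl]

/-- The path of `Ω^t` with prescribed positions. -/
def PathSpace.mk {t : Time T} (f : Time T → E d) (hf : Continuous f) (h : f t = 0) :
    PathSpace d t :=
  ⟨⟨fun r => f (Time.ofIcc r), hf.comp Time.continuous_ofIcc⟩, h⟩

theorem PathSpace.mk_eval {t : Time T} (f : Time T → E d) (hf : Continuous f) (h : f t = 0)
    (r : Time T) : (PathSpace.mk f hf h) r = f (max t r) := by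
  change f (Time.ofIcc (Set.projIcc (t : ℝ) T t.2.2 r)) = _
  rw [ofIcc_projIcc]

/-- Since `ω'` vanishes before `s`, the case distinction collapses to one formula valid at all
times; the identities between paths below then reduce to algebra of `min` and `max`. -/
theorem concat_eval {t s : Time T} (h : t ≤ s) (ω : PathSpace d t) (ω' : PathSpace d s)
    (r : Time T) : (concat h ω ω') r = ω (min r s) + ω' r := by
  change (if Time.ofIcc (Set.projIcc (t : ℝ) T t.2.2 r) < s then
    ω (Time.ofIcc (Set.projIcc (t : ℝ) T t.2.2 r))
    else ω s + ω' (Time.ofIcc (Set.projIcc (t : ℝ) T t.2.2 r))) = _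
  rw [ofIcc_projIcc, eval_max]
  split_ifs with hr
  · have hr' : r < s := (le_max_right _ _).trans_lt hr
    rw [min_eq_left hr'.le, eval_of_le ω' hr'.le, add_zero]
  · rw [not_lt, le_max_iff] at hr
    rcases le_total s r with h1 | h1
    · rw [min_eq_right h1, max_eq_right (h.trans h1)]
    · rcases hr with h2 | h2
      · rw [min_eq_left h1, eval_of_le ω' h1, max_eq_left (h1.trans h2), eval_of_le ω' h,
          eval_of_le ω h2, eval_of_le ω (h1.trans h2)]
      · rw [min_eq_right h2, max_eq_right (h.trans h2)]

theorem trunc_eval {t : Time T} (s : Time T) (ω : PathSpace d t) (r : Time T) :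
    (trunc s ω) r = ω (max s r) - ω s := by
  change ω (Time.ofIcc (Set.projIcc (s : ℝ) T s.2.2 r)) - ω s = _
  rw [ofIcc_projIcc]

/-- The path stopped at time `s`. -/
def stopped {t : Time T} (s : Time T) (ω : PathSpace d t) : PathSpace d t :=
  PathSpace.mk (fun r => ω (min r s))
    ((continuous_eval_path ω).comp (continuous_id.min continuous_const))
    (eval_of_le ω (min_le_left _ _))

theorem stopped_eval {t : Time T} (s : Time T) (ω : PathSpace d t) (r : Time T) :
    (stopped s ω) r = ω (min r s) := by
  rw [stopped, PathSpace.mk_eval]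
  rcases le_total t r with h | h
  · rw [max_eq_right h]
  · rw [eval_of_le ω ((min_le_left _ _).trans h), max_eq_left h, eval_of_le ω (min_le_left _ _)]

theorem stopped_eq_iff {t : Time T} {s : Time T} {ω ω' : PathSpace d t} :
    stopped s ω = stopped s ω' ↔ ∀ r ≤ s, ω r = ω' r := by
  constructor
  · intro h r hr
    have := congrArg (fun p : PathSpace d t => p r) h
    simpa [stopped_eval, min_eq_left hr] using this
  · intro h
    exact PathSpace.ext fun r => by
      rw [stopped_eval, stopped_eval]; exact h _ (min_le_right _ _)

theorem stopped_stopped {t : Time T} (s r : Time T) (ω : PathSpace d t) :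
    stopped r (stopped s ω) = stopped (min r s) ω :=
  PathSpace.ext fun u => by simp only [stopped_eval, min_assoc]

theorem stopped_concat {t s : Time T} (h : t ≤ s) {r : Time T} (hr : s ≤ r) (ω : PathSpace d t)
    (ω' : PathSpace d s) : stopped r (concat h ω ω') = concat h ω (stopped r ω') :=
  PathSpace.ext fun u => by
    rw [stopped_eval, concat_eval, concat_eval, stopped_eval, min_assoc, min_eq_right hr]

theorem stopped_concat_of_le {t s : Time T} (h : t ≤ s) {r : Time T} (hr : r ≤ s)
    (ω : PathSpace d t) (ω' : PathSpace d s) : stopped r (concat h ω ω') = stopped r ω :=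
  stopped_eq_iff.2 fun u hu => by
    rw [concat_eval, min_eq_left (hu.trans hr), eval_of_le ω' (hu.trans hr), add_zero]

theorem stopped_trunc {t s : Time T} {r : Time T} (hr : s ≤ r) (ω : PathSpace d t) :
    trunc s (stopped r ω) = stopped r (trunc s ω) :=
  PathSpace.ext fun u => by
    rw [stopped_eval, trunc_eval, trunc_eval, stopped_eval, stopped_eval, min_eq_left hr,
      max_min_distrib_left, max_eq_right hr]

theorem concat_assoc {t s u : Time T} (h : t ≤ s) (h' : s ≤ u) (ω : PathSpace d t)
    (ω' : PathSpace d s) (ω'' : PathSpace d u) :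
    concat (h.trans h') (concat h ω ω') ω'' = concat h ω (concat h' ω' ω'') :=
  PathSpace.ext fun r => by
    simp only [concat_eval]
    rw [min_assoc, min_eq_right h', add_assoc]

/-- The conditional law at `ω` charges only paths `ω'` agreeing with `ω` up to `s`. For these,
gluing the increments after `s` back onto `ω` loses nothing, which is what transports an integral
over `Ω^t` to one over `Ω^s`. -/
theorem concat_trunc {t s : Time T} (h : t ≤ s) {ω ω' : PathSpace d t}
    (e : stopped s ω = stopped s ω') : concat h ω (trunc s ω') = ω' :=
  PathSpace.ext fun r => by
    rw [stopped_eq_iff] at e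
    rw [concat_eval, trunc_eval, e _ (min_le_right _ _)]
    rcases le_total r s with h1 | h1
    · rw [min_eq_left h1, max_eq_left h1, sub_self, add_zero]
    · rw [min_eq_right h1, max_eq_right h1, add_sub_cancel]

theorem concat_congr {t s : Time T} (h : t ≤ s) {ω₁ ω₂ : PathSpace d t}
    (e : stopped s ω₁ = stopped s ω₂) (ω' : PathSpace d s) : concat h ω₁ ω' = concat h ω₂ ω' :=
  PathSpace.ext fun r => by
    rw [concat_eval, concat_eval, stopped_eq_iff.1 e _ (min_le_right _ _)]

theorem stopped_self {t : Time T} (ω ω' : PathSpace d t) : stopped t ω = stopped t ω' :=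
  stopped_eq_iff.2 fun r hr => by rw [eval_of_le ω hr, eval_of_le ω' hr]

/-! ### The uniform topology -/

instance instMetricSpacePathSpace {t : Time T} : MetricSpace (PathSpace d t) :=
  inferInstanceAs (MetricSpace {ω : C(Set.Icc (t : ℝ) T, E d) // ω ⟨t, le_rfl, t.2.2⟩ = 0})

instance instSecondCountablePathSpace {t : Time T} : SecondCountableTopology (PathSpace d t) :=
  inferInstanceAs (SecondCountableTopology
    {ω : C(Set.Icc (t : ℝ) T, E d) // ω ⟨t, le_rfl, t.2.2⟩ = 0})

instance instPolishSpacePathSpace {t : Time T} : PolishSpace (PathSpace d t) := by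
  have hclosed : IsClosed {ω : C(Set.Icc (t : ℝ) T, E d) | ω ⟨t, le_rfl, t.2.2⟩ = 0} :=
    isClosed_eq (ContinuousEvalConst.continuous_eval_const _) continuous_const
  exact hclosed.polishSpace

theorem norm_eval_sub_le_dist {t : Time T} (ω ω' : PathSpace d t) (r : Time T) :
    ‖ω r - ω' r‖ ≤ dist ω ω' := by
  rw [← dist_eq_norm]
  exact ContinuousMap.dist_apply_le_dist (f := ω.1) (g := ω'.1) _

theorem dist_path_le {t : Time T} {ω ω' : PathSpace d t} {C : ℝ} (hC : 0 ≤ C)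
    (h : ∀ r : Time T, ‖ω r - ω' r‖ ≤ C) : dist ω ω' ≤ C := by
  refine (ContinuousMap.dist_le (f := ω.1) (g := ω'.1) hC).2 fun r => ?_
  have := h (Time.ofIcc r)
  unfold PathSpace.eval at this
  have e : Set.projIcc (t : ℝ) T t.2.2 ((Time.ofIcc r : Time T) : ℝ) = r :=
    Set.projIcc_val t.2.2 r
  rw [e] at this
  rwa [dist_eq_norm]

theorem continuous_eval_const_path {t : Time T} (r : Time T) :
    Continuous fun ω : PathSpace d t => ω r :=
  LipschitzWith.continuous (K := 1) <| LipschitzWith.of_dist_le_mul fun ω ω' => by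
    rw [NNReal.coe_one, one_mul, dist_eq_norm]; exact norm_eval_sub_le_dist ω ω' r

/-- Evaluation along a dense sequence of times is a continuous injection of a Polish space into a
Polish space, hence a measurable embedding (Lusin–Souslin); so finitely many coordinates at a time
already generate every Borel set. -/
instance instBorelSpacePathSpace {t : Time T} : BorelSpace (PathSpace d t) := by
  refine ⟨le_antisymm (iSup_le fun r => ?_) ?_⟩
  · let _ : MeasurableSpace (PathSpace d t) := borel (PathSpace d t)
    have : BorelSpace (PathSpace d t) := ⟨rfl⟩
    exact (continuous_eval_const_path r).measurable.comap_le
  · let m : MeasurableSpace (PathSpace d t) := instMeasurableSpacePathSpace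
    let D : ℕ → Time T :=
      have : Nonempty (Time T) := ⟨t⟩
      TopologicalSpace.denseSeq (Time T)
    let J : PathSpace d t → (ℕ → E d) := fun ω n => ω (D n)
    have hJc : Continuous J := continuous_pi fun n => continuous_eval_const_path _
    have hJm : Measurable J := measurable_pi_lambda _ fun n => measurable_eval (D n)
    have hJi : Function.Injective J := by
      intro ω ω' h
      have : Nonempty (Time T) := ⟨t⟩
      refine PathSpace.ext fun r => congrFun (Continuous.ext_on
        (TopologicalSpace.denseRange_denseSeq (Time T))
        (continuous_eval_path ω) (continuous_eval_path ω') ?_) r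
      rintro _ ⟨n, rfl⟩
      exact congrFun h n
    have hle : borel (PathSpace d t) = MeasurableSpace.comap J MeasurableSpace.pi := by
      let _ : MeasurableSpace (PathSpace d t) := borel (PathSpace d t)
      have : BorelSpace (PathSpace d t) := ⟨rfl⟩
      exact (hJc.measurableEmbedding hJi).comap_eq.symm
    rw [hle]
    exact hJm.comap_le

theorem bddAbove_range_path {t : Time T} (ω : PathSpace d t) :
    ∃ C, ∀ r : Time T, ‖ω r‖ ≤ C := by
  obtain ⟨C, hC⟩ := (isCompact_range (continuous_eval_path ω).norm).bddAbove
  exact ⟨C, fun r => hC ⟨r, rfl⟩⟩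

theorem dist_concat_le {t s : Time T} (h : t ≤ s) (ω₁ ω₂ : PathSpace d t)
    (ω₁' ω₂' : PathSpace d s) :
    dist (concat h ω₁ ω₁') (concat h ω₂ ω₂') ≤ dist ω₁ ω₂ + dist ω₁' ω₂' := by
  refine dist_path_le (by positivity) fun r => ?_
  rw [concat_eval, concat_eval, add_sub_add_comm]
  exact (norm_add_le _ _).trans
    (add_le_add (norm_eval_sub_le_dist _ _ _) (norm_eval_sub_le_dist _ _ _))

theorem continuous_concat {t s : Time T} (h : t ≤ s) :
    Continuous fun p : PathSpace d t × PathSpace d s => concat h p.1 p.2 := by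
  refine continuous_iff_continuousAt.2 fun p => tendsto_iff_dist_tendsto_zero.2 ?_
  refine squeeze_zero (fun _ => dist_nonneg) (fun q => dist_concat_le h q.1 p.1 q.2 p.2) ?_
  have : Continuous fun q : PathSpace d t × PathSpace d s => dist q.1 p.1 + dist q.2 p.2 := by
    fun_prop
  simpa using this.tendsto p

theorem continuous_stopped {t : Time T} (s : Time T) :
    Continuous (stopped s : PathSpace d t → PathSpace d t) :=
  LipschitzWith.continuous (K := 1) <| LipschitzWith.of_dist_le_mul fun ω ω' => by
    rw [NNReal.coe_one, one_mul]
    exact dist_path_le dist_nonneg fun r => by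
      rw [stopped_eval, stopped_eval]; exact norm_eval_sub_le_dist ω ω' _

/-- Uniform continuity of a path. -/
theorem exists_modulus_path {t : Time T} (ω : PathSpace d t) {ε : ℝ} (hε : 0 < ε) :
    ∃ h > 0, ∀ r r' : Time T, |(r : ℝ) - r'| < h → ‖ω r - ω r'‖ < ε := by
  have := CompactSpace.uniformContinuous_of_continuous (continuous_eval_path ω)
  obtain ⟨h, h0, hh⟩ := Metric.uniformContinuous_iff.1 this ε hε
  refine ⟨h, h0, fun r r' hr => ?_⟩
  rw [← dist_eq_norm]
  exact hh (by rwa [Subtype.dist_eq, Real.dist_eq])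

/-! ### The filtration and stopping times -/

theorem measurable_stopped_filt {t : Time T} (s : Time T) :
    Measurable[filt d t s] (stopped s : PathSpace d t → PathSpace d t) := by
  refine @measurable_of_eval d T t _ (filt d t s) _ fun r => ?_
  simp only [stopped_eval]
  have h1 : MeasurableSpace.comap (fun ω : PathSpace d t => ω (min r s)) inferInstance
      ≤ filt d t s :=
    le_iSup₂_of_le (f := fun (j : Time T) (_ : j ≤ s) =>
      MeasurableSpace.comap (fun ω : PathSpace d t => ω j) inferInstance)
      (min r s) (min_le_right _ _) le_rfl
  exact measurable_iff_comap_le.2 h1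

/-- This is the source of the pathwise (Galmarino-type) tests below: membership in an event of time
`s` is decided by the stopped path. -/
theorem filt_eq_comap {t : Time T} (s : Time T) :
    (filt d t s : MeasurableSpace (PathSpace d t))
      = MeasurableSpace.comap (stopped s) instMeasurableSpacePathSpace := by
  apply le_antisymm
  · refine iSup₂_le fun r hr => ?_
    have : (fun ω : PathSpace d t => ω r) = (fun ω : PathSpace d t => ω r) ∘ stopped s := by
      funext ω
      simp only [Function.comp, stopped_eval, min_eq_left hr]
    change MeasurableSpace.comap (fun ω : PathSpace d t => ω r) inferInstance ≤ _
    rw [this, ← MeasurableSpace.comap_comp]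
    exact MeasurableSpace.comap_mono (measurable_eval r).comap_le
  · exact (measurable_stopped_filt s).comap_le

theorem mem_iff_of_stopped_eq {t s : Time T} {A : Set (PathSpace d t)}
    (hA : MeasurableSet[filt d t s] A) {ω ω' : PathSpace d t} (h : stopped s ω = stopped s ω') :
    ω ∈ A ↔ ω' ∈ A := by
  rw [filt_eq_comap] at hA
  obtain ⟨B, -, rfl⟩ := hA
  rw [Set.mem_preimage, Set.mem_preimage, h]

theorem measurableSet_filt_of_stopped {t s : Time T} {A : Set (PathSpace d t)}
    (hA : MeasurableSet A) (h : ∀ ω, ω ∈ A ↔ stopped s ω ∈ A) : MeasurableSet[filt d t s] A := by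
  rw [filt_eq_comap]
  exact ⟨A, hA, Set.ext fun ω => (h ω).symm⟩

theorem measurable_filt_of_stopped {t s : Time T} {f : PathSpace d t → ℝ}
    (hf : Measurable f) (h : ∀ ω, f (stopped s ω) = f ω) : Measurable[filt d t s] f := by
  have e : f = f ∘ stopped s := funext fun ω => (h ω).symm
  rw [e]
  exact hf.comp (measurable_stopped_filt s)

theorem filt_self_eq {t : Time T} {A : Set (PathSpace d t)} (hA : MeasurableSet[filt d t t] A) :
    A = ∅ ∨ A = Set.univ := by
  rcases A.eq_empty_or_nonempty with h | ⟨ω, hω⟩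
  · exact Or.inl h
  · exact Or.inr (Set.eq_univ_of_forall fun ω' =>
      (mem_iff_of_stopped_eq hA (stopped_self ω ω')).1 hω)

theorem stoppingTimes_measurableSet {t : Time T} {γ : PathSpace d t → Time T}
    (h : γ ∈ stoppingTimes d t) (r : Time T) : MeasurableSet[filt d t r] {ω | γ ω ≤ r} := by
  have := h.2 r
  simpa only [WithTop.coe_le_coe] using this

theorem stoppingTimes_measurable {t : Time T} {γ : PathSpace d t → Time T}
    (h : γ ∈ stoppingTimes d t) : Measurable γ :=
  measurable_of_Iic fun r => (filt d t).le r _ (stoppingTimes_measurableSet h r)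

theorem stoppingTimes_le_congr {t : Time T} {γ : PathSpace d t → Time T}
    (h : γ ∈ stoppingTimes d t) {r : Time T} {ω ω' : PathSpace d t}
    (e : stopped r ω = stopped r ω') : γ ω ≤ r ↔ γ ω' ≤ r :=
  mem_iff_of_stopped_eq (stoppingTimes_measurableSet h r) e

theorem stoppingTimes_lt_congr {t : Time T} {γ : PathSpace d t → Time T}
    (h : γ ∈ stoppingTimes d t) {r : Time T} {ω ω' : PathSpace d t}
    (e : stopped r ω = stopped r ω') : γ ω < r ↔ γ ω' < r := by
  have key : ∀ {ω ω' : PathSpace d t}, stopped r ω = stopped r ω' → γ ω < r → γ ω' < r := by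
    intro ω ω' e hl
    refine lt_of_le_of_lt ((stoppingTimes_le_congr h (r := γ ω) ?_).1 le_rfl) hl
    have := congrArg (stopped (γ ω)) e
    rwa [stopped_stopped, stopped_stopped, min_eq_left hl.le] at this
  exact ⟨key e, key e.symm⟩

/-- Test the event `{γ ≤ r'}` at the level `r' = γ ω ≤ r`: the two paths agree up to that level, so
`γ ω' ≤ γ ω`, and the roles can then be exchanged. -/
theorem stoppingTimes_eq_of_le {t : Time T} {γ : PathSpace d t → Time T}
    (h : γ ∈ stoppingTimes d t) {r : Time T} {ω ω' : PathSpace d t}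
    (e : stopped r ω = stopped r ω') (hr : γ ω ≤ r) : γ ω' = γ ω := by
  have key : ∀ {ω ω' : PathSpace d t}, stopped r ω = stopped r ω' → γ ω ≤ r → γ ω' ≤ γ ω := by
    intro ω ω' e hl
    refine (stoppingTimes_le_congr h (r := γ ω) ?_).1 le_rfl
    have := congrArg (stopped (γ ω)) e
    rwa [stopped_stopped, stopped_stopped, min_eq_left hl] at this
  have h1 := key e hr
  exact le_antisymm h1 (key e.symm (h1.trans hr))

/-- Only levels `r ≥ t` need a check, because below `t` the event `{γ ≤ r}` is empty. -/
theorem mem_stoppingTimes {t : Time T} {γ : PathSpace d t → Time T} (hm : Measurable γ)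
    (hle : ∀ ω, t ≤ γ ω) (h : ∀ r, t ≤ r → ∀ ω, γ ω ≤ r ↔ γ (stopped r ω) ≤ r) :
    γ ∈ stoppingTimes d t := by
  refine ⟨hle, fun r => ?_⟩
  simp only [WithTop.coe_le_coe]
  rcases le_or_gt t r with hr | hr
  · exact measurableSet_filt_of_stopped (hm measurableSet_Iic) fun ω => h r hr ω
  · have : {ω : PathSpace d t | γ ω ≤ r} = ∅ :=
      Set.eq_empty_of_forall_notMem fun ω hω => (hr.trans_le (hle ω)).not_ge hω
    rw [this]
    exact @MeasurableSet.empty _ (filt d t r)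

theorem const_mem_stoppingTimes {t s : Time T} (h : t ≤ s) :
    (fun _ => s) ∈ stoppingTimes d t :=
  mem_stoppingTimes measurable_const (fun _ => h) fun _ _ _ => Iff.rfl

theorem measurable_concat_right {t s : Time T} (h : t ≤ s) (ω : PathSpace d t) :
    Measurable (concat h ω) :=
  ((continuous_concat h).comp (continuous_const.prodMk continuous_id)).measurable

theorem comp_trunc_le_iff {t s : Time T} {γ : PathSpace d s → Time T}
    (hγ : γ ∈ stoppingTimes d s) {r : Time T} (ω : PathSpace d t) :
    γ (trunc s ω) ≤ r ↔ γ (trunc s (stopped r ω)) ≤ r := by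
  rcases le_or_gt s r with hr | hr
  · refine stoppingTimes_le_congr hγ ?_
    rw [stopped_trunc hr, stopped_stopped, min_self]
  · exact iff_of_false (hr.trans_le (hγ.1 _)).not_ge (hr.trans_le (hγ.1 _)).not_ge

theorem max_concat_mem_stoppingTimes {t s : Time T} (h : t ≤ s) {γ : PathSpace d t → Time T}
    (hγ : γ ∈ stoppingTimes d t) (ω : PathSpace d t) :
    (fun ω' => max (γ (concat h ω ω')) s) ∈ stoppingTimes d s := by
  refine mem_stoppingTimes
    (((stoppingTimes_measurable hγ).comp (measurable_concat_right h ω)).max measurable_const)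
    (fun _ => le_max_right _ _) fun r hr ω' => ?_
  simp only [max_le_iff]
  refine and_congr_left fun _ => stoppingTimes_le_congr hγ ?_
  rw [stopped_concat h hr, stopped_concat h hr, stopped_stopped, min_self]

theorem min_mem_stoppingTimes {t : Time T} {γ γ' : PathSpace d t → Time T}
    (h : γ ∈ stoppingTimes d t) (h' : γ' ∈ stoppingTimes d t) :
    (fun ω => min (γ ω) (γ' ω)) ∈ stoppingTimes d t := by
  refine mem_stoppingTimes ((stoppingTimes_measurable h).min (stoppingTimes_measurable h'))
    (fun ω => le_min (h.1 ω) (h'.1 ω)) fun r _ ω => ?_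
  simp only [min_le_iff]
  have e : stopped r ω = stopped r (stopped r ω) := by rw [stopped_stopped, min_self]
  rw [stoppingTimes_le_congr h e, stoppingTimes_le_congr h' e]

/-- If `γ(ω) ≥ s`, the stopping time `γ` restarted after `ω` on `[0, s]` is a stopping time. -/
theorem concat_mem_stoppingTimes {t s : Time T} (h : t ≤ s) {γ : PathSpace d t → Time T}
    (hγ : γ ∈ stoppingTimes d t) {ω : PathSpace d t} (hω : s ≤ γ ω) :
    (fun ω' => γ (concat h ω ω')) ∈ stoppingTimes d s := by
  -- The maximum is harmless: `{γ < s}` is decided by the path up to `s`, and it fails at `ω`, hence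
  -- at every path that continues `ω` after `s`.
  have e : (fun ω' => γ (concat h ω ω')) = fun ω' => max (γ (concat h ω ω')) s := by
    funext ω'
    refine (max_eq_left ?_).symm
    rw [← not_lt, ← stoppingTimes_lt_congr hγ (stopped_concat_of_le h le_rfl ω ω').symm, not_lt]
    exact hω
  rw [e]
  exact max_concat_mem_stoppingTimes h hγ ω

/-- The regular conditional probability given `ℱ^t_s` is carried by the paths that agree with the
conditioning path on `[t, s]`. -/
theorem condExpKernel_ae_stopped_eq {t : Time T} (P : ProbabilityMeasure (PathSpace d t))
    (s : Time T) :
    ∀ᵐ ω ∂(P : Measure (PathSpace d t)),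
      ∀ᵐ ω' ∂(condExpKernel (P : Measure (PathSpace d t)) (filt d t s) ω),
        stopped s ω = stopped s ω' := by
  have hm := (filt d t).le s
  refine ae_of_ae_trim hm ?_
  refine Measure.ae_ae_of_ae_compProd
    (p := fun x : PathSpace d t × PathSpace d t => stopped s x.1 = stopped s x.2) ?_
  -- Drawing `ω` and then `ω'` from the kernel gives the law of `(ω, ω)` on the product of `ℱ^t_s`
  -- and the full `σ`-algebra. The event of equal stopped paths is measurable there and contains the
  -- diagonal.
  rw [compProd_trim_condExpKernel hm]
  have h1 : Measurable[(filt d t s).prod instMeasurableSpacePathSpace]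
      (fun x : PathSpace d t × PathSpace d t => stopped s x.1) :=
    (measurable_stopped_filt s).comp (@measurable_fst _ _ (filt d t s) _)
  have h2 : Measurable[(filt d t s).prod instMeasurableSpacePathSpace]
      (fun x : PathSpace d t × PathSpace d t => stopped s x.2) :=
    (continuous_stopped s).measurable.comp (@measurable_snd _ _ (filt d t s) _)
  have h3 : MeasurableSet[(filt d t s).prod instMeasurableSpacePathSpace]
      {x : PathSpace d t × PathSpace d t | stopped s x.1 = stopped s x.2} :=
    @measurableSet_eq_fun _ _ ((filt d t s).prod instMeasurableSpacePathSpace) _ _ _ _ h1 h2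
  have h4 : @Measurable _ _ instMeasurableSpacePathSpace
      ((filt d t s).prod instMeasurableSpacePathSpace)
      (Function.diag : PathSpace d t → PathSpace d t × PathSpace d t) :=
    (measurable_id'' hm).prodMk measurable_id
  exact (@ae_map_iff _ _ instMeasurableSpacePathSpace
    ((filt d t s).prod instMeasurableSpacePathSpace) _ _
    (@Measurable.aemeasurable _ _ _ ((filt d t s).prod instMeasurableSpacePathSpace) _ _ h4) _
    h3).2 (ae_of_all _ fun _ => rfl)

end SnellEnvelope

namespace SnellEnvelope

variable {d : ℕ} {T : ℝ}

/-! ### Regularity of the payoff -/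

theorem IsModulus.zero {ρ : ℝ → ℝ} (h : IsModulus ρ) : ρ 0 = 0 := by
  refine le_antisymm ?_ (h.1 0 le_rfl)
  refine ge_of_tendsto h.2.2 ?_
  filter_upwards [self_mem_nhdsWithin] with x hx
  exact h.2.1 (Set.mem_Ici.2 le_rfl) (Set.mem_Ici.2 (le_of_lt hx)) (le_of_lt hx)

theorem IsModulus.exists_lt {ρ : ℝ → ℝ} (h : IsModulus ρ) {ε : ℝ} (hε : 0 < ε) :
    ∃ x₀ > 0, ∀ x, 0 ≤ x → x < x₀ → ρ x < ε := by
  have := h.2.2.eventually (gt_mem_nhds hε)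
  rw [eventually_nhdsWithin_iff, Metric.eventually_nhds_iff] at this
  obtain ⟨x₀, h0, hx⟩ := this
  refine ⟨x₀, h0, fun x hx0 hlt => ?_⟩
  rcases hx0.eq_or_lt with rfl | hpos
  · rw [h.zero]; exact hε
  · exact hx (by rwa [Real.dist_eq, sub_zero, abs_of_pos hpos]) hpos

theorem IsModulus.mono {ρ : ℝ → ℝ} (h : IsModulus ρ) {x y : ℝ} (hx : 0 ≤ x) (hxy : x ≤ y) :
    ρ x ≤ ρ y :=
  h.2.1 (Set.mem_Ici.2 hx) (Set.mem_Ici.2 (hx.trans hxy)) hxy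

theorem oscAfter_nonneg {t : Time T} (u : Time T) (δ : ℝ) (ω : PathSpace d t) :
    0 ≤ oscAfter u δ ω := Real.iSup_nonneg fun _ => norm_nonneg _

theorem le_oscAfter {t : Time T} {u r : Time T} {δ : ℝ} (ω : PathSpace d t) (h : u ≤ r)
    (h' : (r : ℝ) ≤ u + δ) : ‖ω r - ω u‖ ≤ oscAfter u δ ω := by
  obtain ⟨C, hC⟩ := bddAbove_range_path ω
  refine le_ciSup (f := fun r : {r : Time T // u ≤ r ∧ (r : ℝ) ≤ u + δ} => ‖ω r - ω u‖) ?_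
    ⟨r, h, h'⟩
  refine ⟨C + C, ?_⟩
  rintro _ ⟨r, rfl⟩
  exact (norm_sub_le _ _).trans (add_le_add (hC _) (hC _))

theorem abs_min_sub_min_le_path (x y r : Time T) :
    |((min x r : Time T) : ℝ) - (min y r : Time T)| ≤ |(x : ℝ) - y| := by
  have e : ∀ a b : Time T, ((min a b : Time T) : ℝ) = min (a : ℝ) b := fun a b =>
    Monotone.map_min (f := (Subtype.val : Time T → ℝ)) fun _ _ h => h
  rw [e, e]
  have := abs_min_sub_min_le_max (x : ℝ) r y r
  simpa using this

theorem abs_max_sub_max_le_path (x y r : Time T) :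
    |((max x r : Time T) : ℝ) - (max y r : Time T)| ≤ |(x : ℝ) - y| := by
  have e : ∀ a b : Time T, ((max a b : Time T) : ℝ) = max (a : ℝ) b := fun a b =>
    Monotone.map_max (f := (Subtype.val : Time T → ℝ)) fun _ _ h => h
  rw [e, e]
  have := abs_max_sub_max_le_max (x : ℝ) r y r
  simpa using this

theorem abs_min_left_sub_le (r x y : Time T) :
    |((min r x : Time T) : ℝ) - (min r y : Time T)| ≤ |(x : ℝ) - y| := by
  rw [min_comm r x, min_comm r y]; exact abs_min_sub_min_le_path x y r

variable [Fact (0 < T)]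

theorem dInf_le {t₁ t₂ : Time T} {ω₁ ω₂ : Omega d T} {C : ℝ}
    (h : ∀ r : Time T, ‖ω₁ (min r t₁) - ω₂ (min r t₂)‖ ≤ C) :
    dInf t₁ ω₁ t₂ ω₂ ≤ |(t₁ : ℝ) - t₂| + C := by
  have : Nonempty (Time T) := ⟨t₁⟩
  exact add_le_add le_rfl (ciSup_le h)

theorem dInf_nonneg (t₁ t₂ : Time T) (ω₁ ω₂ : Omega d T) : 0 ≤ dInf t₁ ω₁ t₂ ω₂ :=
  add_nonneg (abs_nonneg _) (Real.iSup_nonneg fun _ => norm_nonneg _)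

theorem oscOn_nonneg (t s : Time T) (ω : Omega d T) : 0 ≤ oscOn t s ω :=
  Real.iSup_nonneg fun _ => norm_nonneg _

theorem le_oscOn {t s r r' : Time T} (ω : Omega d T) (h : t ≤ r) (h' : r ≤ r') (h'' : r' ≤ s) :
    ‖ω r' - ω r‖ ≤ oscOn t s ω := by
  rcases h'.eq_or_lt with rfl | hlt
  · rw [sub_self, norm_zero]; exact oscOn_nonneg _ _ _
  obtain ⟨C, hC⟩ := bddAbove_range_path ω
  refine le_ciSup (f := fun p : {p : Time T × Time T // t ≤ p.1 ∧ p.1 < p.2 ∧ p.2 ≤ s} =>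
    ‖ω p.1.2 - ω p.1.1‖) ?_ ⟨(r, r'), h, hlt, h''⟩
  refine ⟨C + C, ?_⟩
  rintro _ ⟨r, rfl⟩
  exact (norm_sub_le _ _).trans (add_le_add (hC _) (hC _))

section Payoff

variable {Y : Time T → Omega d T → ℝ} {wp : Omega d T → Time T} {M : ℝ} {ρ : ℝ → ℝ} {κ : ℝ}

theorem IsPayoffPair.isModulus (hY : IsPayoffPair Y wp M ρ κ) : IsModulus ρ := hY.modulus_mem.1

theorem IsPayoffPair.abs_stopAt_le (hY : IsPayoffPair Y wp M ρ κ) (t : Time T) (ω : Omega d T) :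
    |stopAt Y wp t ω| ≤ M := hY.bound _ _

theorem IsPayoffPair.lipschitz_dist (hY : IsPayoffPair Y wp M ρ κ) {ω ω' : Omega d T} {C : ℝ}
    (h : ∀ r : Time T, ‖ω r - ω' r‖ ≤ C) : |(wp ω : ℝ) - wp ω'| ≤ κ * C := by
  have : Nonempty (Time T) := ⟨Time.zero T⟩
  exact (hY.lipschitz ω ω').trans (mul_le_mul_of_nonneg_left (ciSup_le h) hY.lipschitz_pos.le)

theorem IsPayoffPair.continuous_wp (hY : IsPayoffPair Y wp M ρ κ) : Continuous wp := by
  refine LipschitzWith.continuous (K := ⟨κ, hY.lipschitz_pos.le⟩) <|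
    LipschitzWith.of_dist_le_mul fun ω ω' => ?_
  rw [Subtype.dist_eq, Real.dist_eq]
  exact hY.lipschitz_dist (norm_eval_sub_le_dist ω ω')

theorem IsPayoffPair.continuous_payoff (hY : IsPayoffPair Y wp M ρ κ) :
    Continuous fun p : Time T × Omega d T => Y p.1 p.2 := by
  refine continuous_iff_continuousAt.2 fun p => Metric.continuousAt_iff.2 fun ε hε => ?_
  obtain ⟨x₀, h0, hx⟩ := hY.isModulus.exists_lt hε
  obtain ⟨h, hh, hω⟩ := exists_modulus_path p.2 (show 0 < x₀ / 4 by positivity)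
  refine ⟨min h (x₀ / 4), by positivity, fun {q} hq => ?_⟩
  rw [Prod.dist_eq, max_lt_iff, lt_min_iff, lt_min_iff] at hq
  obtain ⟨⟨h1, h2⟩, -, h3⟩ := hq
  rw [Subtype.dist_eq, Real.dist_eq] at h1 h2
  rw [Real.dist_eq]
  refine (hY.unifCont _ _ _ _).trans_lt (hx _ (dInf_nonneg _ _ _ _) ?_)
  refine (dInf_le (C := x₀ / 4 + x₀ / 4) fun r => ?_).trans_lt (by linarith)
  have e : q.2 (min r q.1) - p.2 (min r p.1)
      = (q.2 (min r q.1) - p.2 (min r q.1)) + (p.2 (min r q.1) - p.2 (min r p.1)) := by abel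
  rw [e]
  exact (norm_add_le _ _).trans (add_le_add ((norm_eval_sub_le_dist _ _ _).trans h3.le)
    (hω _ _ ((abs_min_left_sub_le _ _ _).trans_lt h1)).le)

theorem IsPayoffPair.continuous_stopAt (hY : IsPayoffPair Y wp M ρ κ) :
    Continuous fun p : Time T × Omega d T => stopAt Y wp p.1 p.2 :=
  hY.continuous_payoff.comp
    (((hY.continuous_wp.comp continuous_snd).min continuous_fst).prodMk continuous_snd)

/-- The modulus forces adaptedness: paths that agree up to `t` are at `dInf`-distance zero at time
`t`, and `ρ 0 = 0`. -/
theorem IsPayoffPair.payoff_congr (hY : IsPayoffPair Y wp M ρ κ) {t : Time T} {ω ω' : Omega d T}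
    (h : stopped t ω = stopped t ω') : Y t ω = Y t ω' := by
  have h1 := hY.unifCont t t ω ω'
  have h2 : dInf t ω t ω' ≤ |(t : ℝ) - t| + 0 := dInf_le fun r => by
    rw [stopped_eq_iff.1 h _ (min_le_right _ _), sub_self, norm_zero]
  rw [sub_self, abs_zero, add_zero] at h2
  rw [le_antisymm h2 (dInf_nonneg _ _ _ _), hY.isModulus.zero] at h1
  exact sub_eq_zero.1 (abs_eq_zero.1 (le_antisymm h1 (abs_nonneg _)))

theorem min_stopping_congr {γ : Omega d T → Time T} (h : γ ∈ stoppingTimes d (Time.zero T))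
    {r : Time T} {ω ω' : Omega d T} (e : stopped r ω = stopped r ω') :
    min (γ ω) r = min (γ ω') r := by
  rcases le_or_gt (γ ω) r with h1 | h1
  · rw [stoppingTimes_eq_of_le h e h1]
  · rw [min_eq_right h1.le]
    have h2 : ¬ γ ω' ≤ r := by rw [← stoppingTimes_le_congr h e]; exact not_le.2 h1
    rw [min_eq_right (not_le.1 h2).le]

theorem IsPayoffPair.stopAt_congr (hY : IsPayoffPair Y wp M ρ κ) {t : Time T} {ω ω' : Omega d T}
    (h : stopped t ω = stopped t ω') : stopAt Y wp t ω = stopAt Y wp t ω' := by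
  unfold stopAt
  rw [min_stopping_congr hY.stopping h]
  refine hY.payoff_congr ?_
  have := congrArg (stopped (min (wp ω') t)) h
  rwa [stopped_stopped, stopped_stopped, min_eq_left (min_le_right _ _)] at this

/-- Pathwise comparison of the payoffs along two concatenated paths. -/
theorem IsPayoffPair.abs_shift_sub_shift_le (hY : IsPayoffPair Y wp M ρ κ) {s t₀ : Time T}
    {ω₁ ω₂ : Omega d T} {D₀ D₁ : ℝ} (hD₀ : 0 ≤ D₀) (hD : D₀ ≤ D₁)
    (h₀ : ∀ u ≤ s, ‖ω₁ u - ω₂ u‖ ≤ D₀)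
    (h₁ : ∀ u v, t₀ ≤ u → t₀ ≤ v → u ≤ s → v ≤ s → |(u : ℝ) - v| ≤ κ * D₀ →
      ‖ω₁ u - ω₂ v‖ ≤ D₁)
    (hts : t₀ ≤ s) (ω' : PathSpace d s)
    (hw₁ : t₀ ≤ wp (concat (Time.zero_le s) ω₁ ω')) (hw₂ : t₀ ≤ wp (concat (Time.zero_le s) ω₂ ω'))
    {r : Time T} (hr : s ≤ r) :
    |shift (stopAt Y wp) s ω₁ r ω' - shift (stopAt Y wp) s ω₂ r ω'| ≤
      ρ ((κ * D₀ + D₁) + oscAfter (min (max (wp (concat (Time.zero_le s) ω₁ ω')) s)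
        (min (max (wp (concat (Time.zero_le s) ω₂ ω')) s) r)) (κ * D₀ + D₁) ω') := by
  set a := concat (Time.zero_le s) ω₁ ω' with ha
  set b := concat (Time.zero_le s) ω₂ ω' with hb
  -- Written this way, `ζ` is visibly a minimum of stopping times of `Ω^s`. In substance it is `(s₁
  -- ∧ s₂) ∨ s`, the time from which the increments of `ω'` can tell the two stopped paths apart.
  set ζ : Time T := min (max (wp a) s) (min (max (wp b) s) r) with hζ
  have hκ := hY.lipschitz_pos
  set s₁ : Time T := min (wp a) r with hs₁
  set s₂ : Time T := min (wp b) r with hs₂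
  have hζ' : ζ = max (min s₁ s₂) s := by
    rw [hζ, hs₁, hs₂]
    have : min (min (wp a) r) (min (wp b) r) = min (wp a) (min (wp b) r) := by
      rw [min_min_min_comm, min_self, min_assoc]
    rw [this, max_min_distrib_right, max_min_distrib_right, max_eq_left hr]
  have hwab : |(wp a : ℝ) - wp b| ≤ κ * D₀ := hY.lipschitz_dist fun u => by
    rw [ha, hb, concat_eval, concat_eval, add_sub_add_right_eq_sub]
    exact h₀ _ (min_le_right _ _)
  have hs12 : |(s₁ : ℝ) - s₂| ≤ κ * D₀ := (abs_min_sub_min_le_path _ _ _).trans hwab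
  have ht1 : t₀ ≤ s₁ := le_min hw₁ (hts.trans hr)
  have ht2 : t₀ ≤ s₂ := le_min hw₂ (hts.trans hr)
  have hosc := oscAfter_nonneg ζ (κ * D₀ + D₁) ω'
  have main : ∀ u : Time T, ‖a (min u s₁) - b (min u s₂)‖
      ≤ D₁ + oscAfter ζ (κ * D₀ + D₁) ω' := by
    intro u
    set x := min u s₁ with hx
    set y := min u s₂ with hy
    have hxy : |(x : ℝ) - y| ≤ κ * D₀ := (abs_min_left_sub_le _ _ _).trans hs12
    -- At equal times the increments of `ω'` cancel and only `ω₁ - ω₂` remains. Different times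
    -- force `u` past `s₁ ∧ s₂`, so that one of `x`, `y` equals `s₁ ∧ s₂`.
    by_cases hne : x = y
    · rw [hne, ha, hb, concat_eval, concat_eval, add_sub_add_right_eq_sub]
      linarith [h₀ (min y s) (min_le_right _ _)]
    have hu : min s₁ s₂ ≤ u := by
      by_contra hu
      rw [not_le, lt_min_iff] at hu
      exact hne (by rw [hx, hy, min_eq_left hu.1.le, min_eq_left hu.2.le])
    have htu : t₀ ≤ u := (le_min ht1 ht2).trans hu
    have hsplit : a x - b y = (ω₁ (min x s) - ω₂ (min y s)) + (ω' x - ω' y) := by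
      rw [ha, hb, concat_eval, concat_eval]; abel
    rw [hsplit]
    refine (norm_add_le _ _).trans (add_le_add ?_ ?_)
    · exact h₁ _ _ (le_min (le_min htu ht1) hts) (le_min (le_min htu ht2) hts)
        (min_le_right _ _) (min_le_right _ _) ((abs_min_sub_min_le_path _ _ _).trans hxy)
    -- After raising both times to at least `s`, the earlier one is `ζ` and the later one exceeds it
    -- by at most `κ * D₀`, so the increment is part of the oscillation after `ζ`.
    · rw [← eval_max ω' x, ← eval_max ω' y, max_comm s x, max_comm s y]
      have hxy' := (abs_max_sub_max_le_path x y s).trans hxy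
      have hD₁ : 0 ≤ D₁ := hD₀.trans hD
      rcases le_total s₁ s₂ with h12 | h12
      · rw [min_eq_left h12] at hu hζ'
        have e : max x s = ζ := by rw [hζ', hx, min_eq_right hu]
        have hle : x ≤ y := min_le_min_left _ h12
        have hle' : max x s ≤ max y s := max_le_max_right _ hle
        rw [norm_sub_rev, e]
        rw [e] at hle' hxy'
        refine le_oscAfter ω' hle' ?_
        have := abs_le.1 hxy'
        linarith [this.1]
      · rw [min_eq_right h12] at hu hζ'
        have e : max y s = ζ := by rw [hζ', hy, min_eq_right hu]
        have hle : y ≤ x := min_le_min_left _ h12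
        have hle' : max y s ≤ max x s := max_le_max_right _ hle
        rw [e]
        rw [e] at hle' hxy'
        refine le_oscAfter ω' hle' ?_
        have := abs_le.1 hxy'
        linarith [this.2]
  refine (hY.unifCont s₁ s₂ a b).trans (hY.isModulus.mono (dInf_nonneg _ _ _ _) ?_)
  refine (dInf_le main).trans ?_
  linarith

/-- Pathwise comparison of the payoffs at two times. -/
theorem IsPayoffPair.stopAt_sub_stopAt_le (hY : IsPayoffPair Y wp M ρ κ) {t : Time T}
    (ω : Omega d T) (ω' : PathSpace d t) {r s : Time T} {h : ℝ} (htr : t ≤ r) (hrs : r ≤ s)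
    (hs : (s : ℝ) ≤ r + h) :
    |shift (stopAt Y wp) t ω r ω' - shift (stopAt Y wp) t ω s ω'| ≤
      ρ (h + oscAfter r h ω') := by
  set a := concat (Time.zero_le t) ω ω' with ha
  refine (hY.unifCont (min (wp a) r) (min (wp a) s) a a).trans
    (hY.isModulus.mono (dInf_nonneg _ _ _ _) ((dInf_le fun u => ?_).trans
      (add_le_add ?_ (le_refl (oscAfter r h ω')))))
  -- If the later clock has passed `r`, the earlier one stands exactly at `r` and the difference is
  -- an increment of `ω'` after `r`. Otherwise the two clocks coincide.
  · by_cases hru : r ≤ min u (min (wp a) s)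
    · have h1 : r ≤ min u (wp a) := le_min (hru.trans (min_le_left _ _))
        (hru.trans ((min_le_right _ _).trans (min_le_left _ _)))
      have e : min u (min (wp a) r) = r := by rw [← min_assoc, min_eq_right h1]
      have hvs : min u (min (wp a) s) ≤ s := (min_le_right _ _).trans (min_le_right _ _)
      rw [e]
      generalize min u (min (wp a) s) = v at *
      rw [ha, concat_eval, concat_eval, min_eq_right htr, min_eq_right (htr.trans hru),
        add_sub_add_left_eq_sub, norm_sub_rev]
      exact le_oscAfter ω' hru ((show (v : ℝ) ≤ s from hvs).trans hs)
    · have e : min u (min (wp a) r) = min u (min (wp a) s) := by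
        rw [not_le] at hru
        refine le_antisymm (min_le_min_left _ (min_le_min_left _ hrs)) ?_
        exact le_min (min_le_left _ _) (le_min ((min_le_right _ _).trans (min_le_left _ _)) hru.le)
      rw [e, sub_self, norm_zero]
      exact oscAfter_nonneg _ _ _
  · refine (abs_min_left_sub_le _ _ _).trans ?_
    rw [abs_le]
    have : (r : ℝ) ≤ s := hrs
    constructor <;> linarith

/-- Once stopped before `t`, the payoff does not move after `t`. -/
theorem IsPayoffPair.shift_eq_of_wp_le (hY : IsPayoffPair Y wp M ρ κ) {t : Time T}
    {ω : Omega d T} (hw : wp ω ≤ t) {r : Time T} (hr : t ≤ r) (ω' : PathSpace d t) :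
    shift (stopAt Y wp) t ω r ω' = Y (wp ω) ω := by
  have e : stopped t (concat (Time.zero_le t) ω ω') = stopped t ω :=
    stopped_concat_of_le _ le_rfl _ _
  have h1 := min_stopping_congr hY.stopping e
  have h2 := (stoppingTimes_le_congr hY.stopping e).2 hw
  rw [min_eq_left hw, min_eq_left h2] at h1
  unfold shift stopAt
  rw [h1, min_eq_left (hw.trans hr)]
  refine hY.payoff_congr ?_
  have := congrArg (stopped (wp ω)) e
  rwa [stopped_stopped, stopped_stopped, min_eq_left hw] at this

theorem IsPayoffPair.measurable_shift (hY : IsPayoffPair Y wp M ρ κ) {t : Time T} (ω : Omega d T)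
    {γ : PathSpace d t → Time T} (hγ : Measurable γ) :
    Measurable fun ω' => shift (stopAt Y wp) t ω (γ ω') ω' :=
  hY.continuous_stopAt.measurable.comp
    (hγ.prodMk (measurable_concat_right (Time.zero_le t) ω))

theorem IsPayoffPair.integrable_shift (hY : IsPayoffPair Y wp M ρ κ) {t : Time T} (ω : Omega d T)
    {γ : PathSpace d t → Time T} (hγ : Measurable γ) (P : ProbabilityMeasure (PathSpace d t)) :
    Integrable (fun ω' => shift (stopAt Y wp) t ω (γ ω') ω') (P : Measure (PathSpace d t)) :=
  Integrable.of_bound (hY.measurable_shift ω hγ).aestronglyMeasurable M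
    (ae_of_all _ fun _ => hY.abs_stopAt_le _ _)

end Payoff

end SnellEnvelope

namespace SnellEnvelope

/-! ### The Snell envelope -/

theorem abs_csSup_sub_csSup_le {ι : Type*} {p : ι → Prop} {f g : ι → ℝ} {C M : ℝ}
    (hne : ∃ i, p i) (hf : ∀ i, p i → f i ≤ M) (hg : ∀ i, p i → g i ≤ M)
    (h : ∀ i, p i → |f i - g i| ≤ C) :
    |sSup {x | ∃ i, p i ∧ x = f i} - sSup {x | ∃ i, p i ∧ x = g i}| ≤ C := by
  have key : ∀ {f g : ι → ℝ}, (∀ i, p i → g i ≤ M) → (∀ i, p i → |f i - g i| ≤ C) →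
      sSup {x | ∃ i, p i ∧ x = f i} ≤ sSup {x | ∃ i, p i ∧ x = g i} + C := by
    intro f g hg h
    obtain ⟨i, hi⟩ := hne
    refine csSup_le ⟨f i, i, hi, rfl⟩ ?_
    rintro _ ⟨i, hi, rfl⟩
    have h1 : g i ≤ sSup {x | ∃ i, p i ∧ x = g i} :=
      le_csSup ⟨M, by rintro _ ⟨j, hj, rfl⟩; exact hg j hj⟩ ⟨i, hi, rfl⟩
    linarith [(abs_le.1 (h i hi)).2]
  have h1 := key hg h
  have h2 := key hf fun i hi => by rw [abs_sub_comm]; exact h i hi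
  rw [abs_le]
  constructor <;> linarith

variable {d : ℕ} {T : ℝ} [Fact (0 < T)]
  {PP : ∀ t : Time T, Set (ProbabilityMeasure (PathSpace d t))}
  {Y : Time T → Omega d T → ℝ} {wp : Omega d T → Time T} {M : ℝ} {ρ ρ₁ : ℝ → ℝ} {κ : ℝ}

/-- Drop the nonnegative oscillation from the bound at the initial time. This supplies the terminal
time, which the move bound does not cover. -/
theorem MoveBound.le (hB : MoveBound PP ρ ρ₁) (hne : ∀ t, (PP t).Nonempty) (hρ : IsModulus ρ)
    (hρ₁ : IsModulus ρ₁) {δ : ℝ} (hδ : 0 < δ) : ρ δ ≤ ρ₁ δ := by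
  obtain ⟨P, hP⟩ := hne (Time.zero T)
  have h := hB (Time.zero T) (Fact.out : 0 < T) δ hδ P hP _ (const_mem_stoppingTimes le_rfl)
  have h2 : ENNReal.ofReal (ρ δ) ≤ ENNReal.ofReal (ρ₁ δ) := by
    refine le_trans ?_ h
    calc ENNReal.ofReal (ρ δ)
        = ∫⁻ _, ENNReal.ofReal (ρ δ) ∂(P : Measure (PathSpace d (Time.zero T))) := by simp
      _ ≤ _ := lintegral_mono fun ω => ENNReal.ofReal_le_ofReal
          (hρ.mono hδ.le (le_add_of_nonneg_right (oscAfter_nonneg _ _ _)))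
  exact (ENNReal.ofReal_le_ofReal_iff (hρ₁.1 _ hδ.le)).1 h2

/-- Expected increments are controlled also at the terminal time. -/
theorem MoveBound.integral_le (hB : MoveBound PP ρ ρ₁) (hne : ∀ t, (PP t).Nonempty)
    (hρ : IsModulus ρ) (hρ₁ : IsModulus ρ₁) {δ : ℝ} (hδ : 0 < δ) {s : Time T}
    {P : ProbabilityMeasure (PathSpace d s)} (hP : P ∈ PP s) {ζ : PathSpace d s → Time T}
    (hζ : ζ ∈ stoppingTimes d s) {f : PathSpace d s → ℝ}
    (hf : Integrable f (P : Measure (PathSpace d s)))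
    (h : ∀ ω, |f ω| ≤ ρ (δ + oscAfter (ζ ω) δ ω)) :
    ∫ ω, |f ω| ∂(P : Measure (PathSpace d s)) ≤ ρ₁ δ := by
  have hle : ∫⁻ ω, ENNReal.ofReal (ρ (δ + oscAfter (ζ ω) δ ω)) ∂(P : Measure (PathSpace d s))
      ≤ ENNReal.ofReal (ρ₁ δ) := by
    rcases s.2.2.lt_or_eq with hs | hs
    · exact hB s hs δ hδ P hP ζ hζ
    · have hosc : ∀ (u : Time T) (ω : PathSpace d s), oscAfter u δ ω = 0 := fun u ω => by
        unfold oscAfter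
        have : ∀ r : Time T, ω r = 0 := fun r => eval_of_le ω (show (r : ℝ) ≤ s by rw [hs]; exact r.2.2)
        simp [this]
      simp only [hosc, add_zero, lintegral_const, measure_univ, mul_one]
      exact ENNReal.ofReal_le_ofReal (hB.le hne hρ hρ₁ hδ)
  rw [integral_eq_lintegral_of_nonneg_ae (ae_of_all _ fun _ => abs_nonneg _)
    hf.abs.aestronglyMeasurable]
  refine ENNReal.toReal_le_of_le_ofReal (hρ₁.1 _ hδ.le) (le_trans (lintegral_mono fun ω => ?_) hle)
  exact ENNReal.ofReal_le_ofReal (h ω)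

/-- The radius and the length of the window in the pathwise comparison are both `κ * D₀ + D₁`, and
`ζ` there is a stopping time, so a single use of the move bound suffices. The level `t₀` serves two
regimes: `t₀ = 0` with the modulus of continuity of `ω₁`, and `t₀ = t` with the oscillation on `[t,
s]` when `wp` has not occurred before `t`. -/
theorem IsPayoffPair.abs_integral_sub_le (hY : IsPayoffPair Y wp M ρ κ) (hB : MoveBound PP ρ ρ₁)
    (hne : ∀ t, (PP t).Nonempty) (hρ₁ : IsModulus ρ₁) {s t₀ : Time T}
    {ω₁ ω₂ : Omega d T} {D₀ D₁ : ℝ} (hD₀ : 0 ≤ D₀) (hD : D₀ ≤ D₁) (hpos : 0 < κ * D₀ + D₁)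
    (h₀ : ∀ u ≤ s, ‖ω₁ u - ω₂ u‖ ≤ D₀)
    (h₁ : ∀ u v, t₀ ≤ u → t₀ ≤ v → u ≤ s → v ≤ s → |(u : ℝ) - v| ≤ κ * D₀ →
      ‖ω₁ u - ω₂ v‖ ≤ D₁)
    (hts : t₀ ≤ s)
    (hw₁ : ∀ ω', t₀ ≤ wp (concat (Time.zero_le s) ω₁ ω'))
    (hw₂ : ∀ ω', t₀ ≤ wp (concat (Time.zero_le s) ω₂ ω'))
    {P : ProbabilityMeasure (PathSpace d s)} (hP : P ∈ PP s)
    {γ : PathSpace d s → Time T} (hγ : γ ∈ stoppingTimes d s) :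
    |∫ ω', shift (stopAt Y wp) s ω₁ (γ ω') ω' ∂(P : Measure (PathSpace d s))
      - ∫ ω', shift (stopAt Y wp) s ω₂ (γ ω') ω' ∂(P : Measure (PathSpace d s))|
      ≤ ρ₁ (κ * D₀ + D₁) := by
  have hγm := stoppingTimes_measurable hγ
  have i1 := hY.integrable_shift ω₁ hγm P
  have i2 := hY.integrable_shift ω₂ hγm P
  rw [← integral_sub i1 i2]
  refine abs_integral_le_integral_abs.trans ?_
  exact hB.integral_le hne hY.isModulus hρ₁ hpos hP
    (min_mem_stoppingTimes (max_concat_mem_stoppingTimes (Time.zero_le s) hY.stopping ω₁)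
      (min_mem_stoppingTimes (max_concat_mem_stoppingTimes (Time.zero_le s) hY.stopping ω₂) hγ))
    (i1.sub i2) fun ω' => hY.abs_shift_sub_shift_le hD₀ hD h₀ h₁ hts ω' (hw₁ ω') (hw₂ ω')
      (hγ.1 ω')

theorem IsPayoffPair.abs_integral_shift_le (hY : IsPayoffPair Y wp M ρ κ) {s : Time T}
    (ω : Omega d T) (P : ProbabilityMeasure (PathSpace d s)) (γ : PathSpace d s → Time T) :
    |∫ ω', shift (stopAt Y wp) s ω (γ ω') ω' ∂(P : Measure (PathSpace d s))| ≤ M := by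
  have := norm_integral_le_of_norm_le_const (μ := (P : Measure (PathSpace d s)))
    (f := fun ω' => shift (stopAt Y wp) s ω (γ ω') ω') (C := M)
    (ae_of_all _ fun ω' => hY.abs_stopAt_le _ _)
  simpa using this

theorem snell_eq (X : Time T → Omega d T → ℝ) (t : Time T) (ω : Omega d T) :
    snell PP X t ω = sSup {x : ℝ | ∃ i : ProbabilityMeasure (PathSpace d t) ×
      (PathSpace d t → Time T), (i.1 ∈ PP t ∧ i.2 ∈ stoppingTimes d t) ∧
      x = ∫ ω', shift X t ω (i.2 ω') ω' ∂(i.1 : Measure (PathSpace d t))} := by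
  unfold snell
  congr 1
  ext x
  constructor
  · rintro ⟨P, hP, γ, hγ, rfl⟩; exact ⟨(P, γ), ⟨hP, hγ⟩, rfl⟩
  · rintro ⟨⟨P, γ⟩, ⟨hP, hγ⟩, rfl⟩; exact ⟨P, hP, γ, hγ, rfl⟩

theorem IsPayoffPair.le_snell (hY : IsPayoffPair Y wp M ρ κ) {t : Time T} (ω : Omega d T)
    {P : ProbabilityMeasure (PathSpace d t)} (hP : P ∈ PP t) {γ : PathSpace d t → Time T}
    (hγ : γ ∈ stoppingTimes d t) :
    ∫ ω', shift (stopAt Y wp) t ω (γ ω') ω' ∂(P : Measure (PathSpace d t))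
      ≤ snell PP (stopAt Y wp) t ω :=
  le_csSup ⟨M, by
    rintro _ ⟨P, -, γ, -, rfl⟩
    exact (abs_le.1 (hY.abs_integral_shift_le ω P γ)).2⟩ ⟨P, hP, γ, hγ, rfl⟩

theorem snell_le (hne : ∀ t, (PP t).Nonempty) {X : Time T → Omega d T → ℝ} {t : Time T}
    {ω : Omega d T} {c : ℝ}
    (h : ∀ P ∈ PP t, ∀ γ ∈ stoppingTimes d t,
      ∫ ω', shift X t ω (γ ω') ω' ∂(P : Measure (PathSpace d t)) ≤ c) :
    snell PP X t ω ≤ c := by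
  obtain ⟨P, hP⟩ := hne t
  refine csSup_le ⟨_, P, hP, _, const_mem_stoppingTimes le_rfl, rfl⟩ ?_
  rintro _ ⟨P, hP, γ, hγ, rfl⟩
  exact h P hP γ hγ

theorem exists_lt_snell (hne : ∀ t, (PP t).Nonempty) {X : Time T → Omega d T → ℝ} {t : Time T}
    {ω : Omega d T} {ε : ℝ} (hε : 0 < ε) :
    ∃ P ∈ PP t, ∃ γ ∈ stoppingTimes d t, snell PP X t ω - ε <
      ∫ ω', shift X t ω (γ ω') ω' ∂(P : Measure (PathSpace d t)) := by
  by_contra! h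
  linarith [snell_le hne h]

theorem IsPayoffPair.abs_snell_le (hY : IsPayoffPair Y wp M ρ κ) (hne : ∀ t, (PP t).Nonempty)
    (t : Time T) (ω : Omega d T) : |snell PP (stopAt Y wp) t ω| ≤ M := by
  obtain ⟨P, hP⟩ := hne t
  rw [abs_le]
  exact ⟨(abs_le.1 (hY.abs_integral_shift_le ω P _)).1.trans
      (hY.le_snell ω hP (const_mem_stoppingTimes le_rfl)),
    snell_le hne fun P _ γ _ => (abs_le.1 (hY.abs_integral_shift_le ω P γ)).2⟩

theorem IsPayoffPair.abs_snell_sub_le (hY : IsPayoffPair Y wp M ρ κ)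
    (hne : ∀ t, (PP t).Nonempty) {s : Time T} {ω₁ ω₂ : Omega d T} {C : ℝ}
    (h : ∀ P ∈ PP s, ∀ γ ∈ stoppingTimes d s,
      |∫ ω', shift (stopAt Y wp) s ω₁ (γ ω') ω' ∂(P : Measure (PathSpace d s))
      - ∫ ω', shift (stopAt Y wp) s ω₂ (γ ω') ω' ∂(P : Measure (PathSpace d s))| ≤ C) :
    |snell PP (stopAt Y wp) s ω₁ - snell PP (stopAt Y wp) s ω₂| ≤ C := by
  rw [snell_eq, snell_eq]
  obtain ⟨P, hP⟩ := hne s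
  exact abs_csSup_sub_csSup_le (M := M) ⟨(P, _), hP, const_mem_stoppingTimes le_rfl⟩
    (fun i _ => (abs_le.1 (hY.abs_integral_shift_le _ _ _)).2)
    (fun i _ => (abs_le.1 (hY.abs_integral_shift_le _ _ _)).2)
    fun i hi => h i.1 hi.1 i.2 hi.2

/-- The expected payoffs are continuous in the starting path, uniformly over the controls. -/
theorem IsPayoffPair.exists_abs_integral_sub_le (hY : IsPayoffPair Y wp M ρ κ)
    (hne : ∀ t, (PP t).Nonempty) (hP2 : HasMoveBounds PP) (s : Time T) (ω₁ : Omega d T) {ε : ℝ}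
    (hε : 0 < ε) :
    ∃ η > 0, ∀ ω₂ : Omega d T, (∀ u ≤ s, ‖ω₁ u - ω₂ u‖ ≤ η) →
      ∀ P ∈ PP s, ∀ γ ∈ stoppingTimes d s,
      |∫ ω', shift (stopAt Y wp) s ω₁ (γ ω') ω' ∂(P : Measure (PathSpace d s))
      - ∫ ω', shift (stopAt Y wp) s ω₂ (γ ω') ω' ∂(P : Measure (PathSpace d s))| ≤ ε := by
  obtain ⟨ρ₁, hρ₁, hB⟩ := hP2 ρ hY.modulus_mem
  obtain ⟨x₀, h0, hx⟩ := hρ₁.1.exists_lt hε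
  obtain ⟨h, hh, hω⟩ := exists_modulus_path ω₁ (show 0 < x₀ / 4 by positivity)
  have hκ := hY.lipschitz_pos
  -- The first bound keeps times that differ by `κ * η` within the modulus `h` of `ω₁`; the second
  -- makes `κ * η + (η + x₀ / 4)` at most `x₀ / 2`. Thus `η` depends on `ω₁`, through its modulus,
  -- but on no control.
  set η := min (h / (2 * κ)) (x₀ / (4 * (κ + 1))) with hη
  have hη0 : 0 < η := by positivity
  have hη1 : κ * η < h := by
    have : κ * η ≤ κ * (h / (2 * κ)) := by gcongr; exact min_le_left _ _
    have e : κ * (h / (2 * κ)) = h / 2 := by field_simp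
    linarith
  have hη2 : (κ + 1) * η ≤ x₀ / 4 := by
    have : (κ + 1) * η ≤ (κ + 1) * (x₀ / (4 * (κ + 1))) := by gcongr; exact min_le_right _ _
    have e : (κ + 1) * (x₀ / (4 * (κ + 1))) = x₀ / 4 := by field_simp
    linarith
  refine ⟨η, hη0, fun ω₂ h2 P hP γ hγ => ?_⟩
  have hpos : 0 < κ * η + (η + x₀ / 4) := by positivity
  refine (hY.abs_integral_sub_le hB hne hρ₁.1 (t₀ := Time.zero T) (D₀ := η) (D₁ := η + x₀ / 4)
    hη0.le (by linarith) hpos h2 ?_ (Time.zero_le s) (fun _ => Time.zero_le _)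
    (fun _ => Time.zero_le _) hP hγ).trans (hx _ hpos.le (by linarith)).le
  intro u v _ _ _ hv huv
  have e : ω₁ u - ω₂ v = (ω₁ u - ω₁ v) + (ω₁ v - ω₂ v) := by abel
  rw [e]
  refine (norm_add_le _ _).trans ?_
  linarith [h2 v hv, hω u v (huv.trans_lt hη1)]

theorem IsPayoffPair.continuous_snell (hY : IsPayoffPair Y wp M ρ κ) (hne : ∀ t, (PP t).Nonempty)
    (hP2 : HasMoveBounds PP) (s : Time T) : Continuous (snell PP (stopAt Y wp) s) := by
  refine continuous_iff_continuousAt.2 fun ω => Metric.continuousAt_iff.2 fun ε hε => ?_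
  obtain ⟨η, hη, h⟩ := hY.exists_abs_integral_sub_le hne hP2 s ω (half_pos hε)
  refine ⟨η, hη, fun {ω₂} h2 => ?_⟩
  rw [dist_comm, Real.dist_eq]
  refine (hY.abs_snell_sub_le hne (h ω₂ fun u _ => ?_)).trans_lt (half_lt_self hε)
  rw [dist_comm] at h2
  exact (norm_eval_sub_le_dist _ _ _).trans h2.le

theorem snell_congr (X : Time T → Omega d T → ℝ) {s : Time T} {ω₁ ω₂ : Omega d T}
    (h : stopped s ω₁ = stopped s ω₂) : snell PP X s ω₁ = snell PP X s ω₂ := by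
  unfold snell shift
  simp only [concat_congr (Time.zero_le s) h]

/-- Continuity on `Ω` gives measurability, and dependence on the stopped path alone upgrades it to
`ℱ_s`. -/
theorem IsPayoffPair.measurable_snell_filt (hY : IsPayoffPair Y wp M ρ κ)
    (hne : ∀ t, (PP t).Nonempty) (hP2 : HasMoveBounds PP) (s : Time T) :
    Measurable[filt d (Time.zero T) s] (snell PP (stopAt Y wp) s) :=
  measurable_filt_of_stopped (hY.continuous_snell hne hP2 s).measurable fun ω =>
    snell_congr _ (by rw [stopped_stopped, min_self])

theorem IsPayoffPair.continuous_shift_snell (hY : IsPayoffPair Y wp M ρ κ)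
    (hne : ∀ t, (PP t).Nonempty) (hP2 : HasMoveBounds PP) {t : Time T} (s : Time T)
    (ω : Omega d T) :
    Continuous fun ω' : PathSpace d t => shift (snell PP (stopAt Y wp)) t ω s ω' :=
  (hY.continuous_snell hne hP2 s).comp
    ((continuous_concat (Time.zero_le t)).comp (continuous_const.prodMk continuous_id))

theorem IsPayoffPair.integrable_shift_snell (hY : IsPayoffPair Y wp M ρ κ)
    (hne : ∀ t, (PP t).Nonempty) (hP2 : HasMoveBounds PP) {t : Time T} (s : Time T)
    (ω : Omega d T) (P : ProbabilityMeasure (PathSpace d t)) :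
    Integrable (fun ω' => shift (snell PP (stopAt Y wp)) t ω s ω') (P : Measure (PathSpace d t)) :=
  Integrable.of_bound
    (hY.continuous_shift_snell hne hP2 s ω).measurable.aestronglyMeasurable M
    (ae_of_all _ fun _ => hY.abs_snell_le hne _ _)

/-- Stopping at once is admissible, and its payoff is the constant `Ŷ_t(ω)`. -/
theorem IsPayoffPair.stopAt_le_snell (hY : IsPayoffPair Y wp M ρ κ)
    (hne : ∀ t, (PP t).Nonempty) (t : Time T) (ω : Omega d T) :
    stopAt Y wp t ω ≤ snell PP (stopAt Y wp) t ω := by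
  obtain ⟨P, hP⟩ := hne t
  have h := hY.le_snell ω hP (const_mem_stoppingTimes le_rfl)
  have e : ∀ ω' : PathSpace d t, shift (stopAt Y wp) t ω t ω' = stopAt Y wp t ω := fun ω' =>
    hY.stopAt_congr (stopped_concat_of_le _ le_rfl _ _)
  simpa [e] using h

/-! ### Conditioning -/

/-- The set where `p` holds need not be measurable for `m`. Any event of `m` on which `p` fails is
nevertheless null, as it lies in the complement of the full set of the extension. -/
theorem HoldsOnExtension.measure_eq_zero {α : Type*} [m : MeasurableSpace α] {μ : Measure α}
    [IsProbabilityMeasure μ] {p : α → Prop} (h : HoldsOnExtension m μ p) {F : Set α}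
    (hF : MeasurableSet F) (hp : ∀ ω ∈ F, ¬ p ω) : μ F = 0 := by
  obtain ⟨m', hm, μ', S, htrim, hS, hS1, hpS⟩ := h
  have e : ∀ A, MeasurableSet[m] A → μ' A = μ A := fun A hA => by
    rw [← htrim, trim_measurableSet_eq hm hA]
  have huniv : μ' Set.univ = 1 := by rw [e _ MeasurableSet.univ, measure_univ]
  have hfin : IsFiniteMeasure μ' := ⟨by rw [huniv]; exact ENNReal.one_lt_top⟩
  have hc : μ' Sᶜ = 0 := by
    rw [measure_compl hS (measure_ne_top _ _), hS1, huniv, tsub_self]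
  rw [← e F hF]
  exact measure_mono_null (fun ω hω hωS => hp ω hω (hpS ω hωS)) hc

end SnellEnvelope

namespace SnellEnvelope

variable {d : ℕ} {T : ℝ} [Fact (0 < T)]
  {PP : ∀ t : Time T, Set (ProbabilityMeasure (PathSpace d t))}
  {Y : Time T → Omega d T → ℝ} {wp : Omega d T → Time T} {M : ℝ} {ρ ρ₁ : ℝ → ℝ} {κ : ℝ}

theorem shift_snell_self (X : Time T → Omega d T → ℝ) (t : Time T) (ω : Omega d T)
    (ω' : PathSpace d t) : shift (snell PP X) t ω t ω' = snell PP X t ω :=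
  snell_congr X (stopped_concat_of_le _ le_rfl _ _)

theorem shift_concat (X : Time T → Omega d T → ℝ) {t s : Time T} (h : t ≤ s) (ω : Omega d T)
    (ω' : PathSpace d t) (r : Time T) (ω'' : PathSpace d s) :
    shift X s (concat (Time.zero_le t) ω ω') r ω'' = shift X t ω r (concat h ω' ω'') :=
  congrArg (X r) (concat_assoc (Time.zero_le t) h ω ω' ω'')

/-- On events of `ℱ^t_s` on which `γ ≥ s`, the expected payoff is at most that of the envelope at
time `s`. -/
theorem IsPayoffPair.setIntegral_shift_le (hY : IsPayoffPair Y wp M ρ κ)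
    (hne : ∀ t, (PP t).Nonempty) (hP2 : HasMoveBounds PP) (hP3 : ShiftInvariant PP)
    {t s : Time T} (hts : t ≤ s) (ω : Omega d T) {P : ProbabilityMeasure (PathSpace d t)}
    (hP : P ∈ PP t) {γ : PathSpace d t → Time T} (hγ : γ ∈ stoppingTimes d t)
    {D : Set (PathSpace d t)} (hD : MeasurableSet[filt d t s] D) (hDγ : ∀ ω' ∈ D, s ≤ γ ω') :
    ∫ ω' in D, shift (stopAt Y wp) t ω (γ ω') ω' ∂(P : Measure (PathSpace d t))
      ≤ ∫ ω' in D, shift (snell PP (stopAt Y wp)) t ω s ω' ∂(P : Measure (PathSpace d t)) := by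
  -- The assumption on shifts concerns `t < s` only; for `s = t` the `σ`-algebra is trivial and `D`
  -- is empty or everything.
  rcases hts.eq_or_lt with rfl | hlt
  · rcases filt_self_eq hD with rfl | rfl
    · simp
    · simp only [shift_snell_self, Measure.restrict_univ]
      simpa using hY.le_snell ω hP hγ
  have hm := (filt d t).le s
  set f : PathSpace d t → ℝ := fun ω' => shift (stopAt Y wp) t ω (γ ω') ω' with hf
  have hfi : Integrable f (P : Measure (PathSpace d t)) :=
    hY.integrable_shift ω (stoppingTimes_measurable hγ) P
  have hfm : Measurable f := hY.measurable_shift ω (stoppingTimes_measurable hγ)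
  set g : PathSpace d t → ℝ := fun ω' =>
    ∫ y, f y ∂(condExpKernel (P : Measure (PathSpace d t)) (filt d t s) ω') with hg
  have hgm : Measurable g :=
    (hfm.stronglyMeasurable.integral_condExpKernel (m := filt d t s)).measurable.mono hm le_rfl
  have hce : (P : Measure (PathSpace d t))[f | filt d t s] =ᵐ[(P : Measure (PathSpace d t))] g :=
    condExp_ae_eq_integral_condExpKernel hm hfi
  rw [← setIntegral_condExp hm hfi hD]
  refine setIntegral_mono_on_ae integrable_condExp.integrableOn
    (hY.integrable_shift_snell hne hP2 s ω P).integrableOn (hm _ hD) ?_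
  set N := toMeasurable (P : Measure (PathSpace d t)) {ω' | ¬ ∀ᵐ ω''
    ∂(condExpKernel (P : Measure (PathSpace d t)) (filt d t s) ω'), stopped s ω' = stopped s ω''}
    with hN
  have hN0 : (P : Measure (PathSpace d t)) N = 0 := by
    rw [hN, measure_toMeasurable]; exact condExpKernel_ae_stopped_eq P s
  have hZm := (hY.continuous_shift_snell hne hP2 s ω (t := t)).measurable
  -- The exceptional set is kept measurable by removing the null set `N`. At a point of it the
  -- shifted probability cannot lie in `PP s`: otherwise `g` would be the value of an admissible
  -- pair for the envelope at `s`, against `Z_s < g`.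
  have hF : (P : Measure (PathSpace d t))
      ((D ∩ {ω' | shift (snell PP (stopAt Y wp)) t ω s ω' < g ω'}) \ N) = 0 := by
    refine (hP3 t s hlt P hP).measure_eq_zero
      (((hm _ hD).inter (measurableSet_lt hZm hgm)).diff (measurableSet_toMeasurable _ _)) ?_
    rintro ω' ⟨⟨h1, h2⟩, h3⟩ hmem
    have hconc := not_not.1 fun hc => h3 (subset_toMeasurable _ _ hc)
    refine absurd ?_ (not_le.2 (show _ < g ω' from h2))
    have e : g ω' = ∫ ω'', shift (stopAt Y wp) s (concat (Time.zero_le t) ω ω')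
        (γ (concat hlt.le ω' ω'')) ω'' ∂(shiftedProb P s ω' : Measure (PathSpace d s)) := by
      change _ = ∫ ω'', shift (stopAt Y wp) s (concat (Time.zero_le t) ω ω')
        (γ (concat hlt.le ω' ω'')) ω'' ∂((condExpKernel (P : Measure (PathSpace d t))
          (filt d t s) ω').map (trunc s))
      rw [integral_map (measurable_trunc s).aemeasurable]
      · refine integral_congr_ae ?_
        filter_upwards [hconc] with ω'' h
        rw [shift_concat _ hlt.le, concat_trunc hlt.le h]
      · exact (hY.measurable_shift _ ((stoppingTimes_measurable hγ).comp
          (measurable_concat_right hlt.le ω'))).aestronglyMeasurable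
    rw [e]
    exact hY.le_snell _ hmem (concat_mem_stoppingTimes hlt.le hγ (hDγ ω' h1))
  filter_upwards [hce, measure_eq_zero_iff_ae_notMem.1 hF, measure_eq_zero_iff_ae_notMem.1 hN0]
    with ω' h1 h2 h3 hω'
  rw [h1]
  by_contra hc
  exact h2 ⟨⟨hω', not_le.1 hc⟩, h3⟩

end SnellEnvelope

namespace SnellEnvelope

variable {d : ℕ} {T : ℝ}

/-! ### Pasting -/

theorem supDist_eq_dist {t s : Time T} (h : t ≤ s) (ω ω' : PathSpace d t) :
    supDist s ω ω' = dist (stopped s ω) (stopped s ω') := by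
  have : Nonempty {r : Time T // t ≤ r ∧ r ≤ s} := ⟨⟨t, le_rfl, h⟩⟩
  have key : ∀ r : {r : Time T // t ≤ r ∧ r ≤ s},
      ‖ω r - ω' r‖ ≤ dist (stopped s ω) (stopped s ω') := fun r => by
    have := norm_eval_sub_le_dist (stopped s ω) (stopped s ω') r
    rwa [stopped_eval, stopped_eval, min_eq_left r.2.2] at this
  refine le_antisymm (ciSup_le key) ?_
  refine dist_path_le (Real.iSup_nonneg fun _ => norm_nonneg _) fun r => ?_
  rw [stopped_eval, stopped_eval]
  rcases le_total t r with hr | hr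
  · exact le_ciSup (f := fun r : {r : Time T // t ≤ r ∧ r ≤ s} => ‖ω r - ω' r‖)
      ⟨_, by rintro _ ⟨r, rfl⟩; exact key r⟩ ⟨min r s, le_min hr h, min_le_right _ _⟩
  · have hr' := (min_le_left r s).trans hr
    rw [eval_of_le ω hr', eval_of_le ω' hr', sub_self, norm_zero]
    exact Real.iSup_nonneg fun _ => norm_nonneg _

theorem pathBall_eq {t s : Time T} (h : t ≤ s) (δ : ℝ) (ω : PathSpace d t) :
    pathBall s δ ω = stopped s ⁻¹' Metric.ball (stopped s ω) δ := by
  ext ω'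
  rw [pathBall, Set.mem_ofPred_eq, supDist_eq_dist h, Set.mem_preimage, Metric.mem_ball]

theorem measurableSet_pathBall {t s : Time T} (h : t ≤ s) (δ : ℝ) (ω : PathSpace d t) :
    MeasurableSet[filt d t s] (pathBall s δ ω) := by
  rw [pathBall_eq h]
  exact measurable_stopped_filt s Metric.isOpen_ball.measurableSet

theorem pathBall_mem_nhds {t s : Time T} (h : t ≤ s) {δ : ℝ} (hδ : 0 < δ) (ω : PathSpace d t) :
    pathBall s δ ω ∈ 𝓝 ω := by
  rw [pathBall_eq h]
  exact (Metric.isOpen_ball.preimage (continuous_stopped s)).mem_nhds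
    (by rw [Set.mem_preimage]; exact Metric.mem_ball_self hδ)

/-- A countable measurable partition of `Ω^t` subordinate to balls of prescribed radii. -/
theorem exists_partition_pathBall {t s : Time T} (h : t ≤ s) [Nonempty (PathSpace d t)]
    {δ : PathSpace d t → ℝ} (hδ : ∀ ω, 0 < δ ω) :
    ∃ (x : ℕ → PathSpace d t) (N : PathSpace d t → ℕ),
      (∀ n, MeasurableSet[filt d t s] {ω | N ω = n}) ∧ ∀ ω, ω ∈ pathBall s (δ (x (N ω))) (x (N ω)) := by
  classical
  obtain ⟨S, hS, hcov⟩ := TopologicalSpace.countable_cover_nhds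
    fun ω : PathSpace d t => pathBall_mem_nhds h (hδ ω) ω
  have hSne : S.Nonempty := by
    obtain ⟨ω⟩ := ‹Nonempty (PathSpace d t)›
    have : ω ∈ ⋃ x ∈ S, pathBall s (δ x) x := hcov ▸ Set.mem_univ ω
    obtain ⟨x, hx, -⟩ := Set.mem_iUnion₂.1 this
    exact ⟨x, hx⟩
  obtain ⟨x, rfl⟩ := hS.exists_eq_range hSne
  have hex : ∀ ω, ∃ n, ω ∈ pathBall s (δ (x n)) (x n) := fun ω => by
    have : ω ∈ ⋃ y ∈ Set.range x, pathBall s (δ y) y := hcov ▸ Set.mem_univ ω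
    simpa using this
  refine ⟨x, fun ω => Nat.find (hex ω), fun n => ?_, fun ω => Nat.find_spec (hex ω)⟩
  have e : {ω | Nat.find (hex ω) = n} = pathBall s (δ (x n)) (x n) ∩
      ⋂ k : {k : ℕ // k < n}, (pathBall s (δ (x k)) (x k))ᶜ := by
    ext ω
    simp [Nat.find_eq_iff]
  rw [e]
  exact @MeasurableSet.inter _ (filt d t s) _ _ (measurableSet_pathBall h _ _)
    (@MeasurableSet.iInter _ _ (filt d t s) _ _ fun k =>
      @MeasurableSet.compl _ _ (filt d t s) (measurableSet_pathBall h _ _))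

/-- Before `s` the new time behaves like `γ`, since on `D` both are at least `s`; from `s` on,
membership in `D` and the index `N` are known. -/
theorem paste_mem_stoppingTimes {t s : Time T} {γ : PathSpace d t → Time T}
    (hγ : γ ∈ stoppingTimes d t) (hts : t ≤ s) {D : Set (PathSpace d t)}
    [DecidablePred (· ∈ D)] (hD : MeasurableSet[filt d t s] D) (hDγ : ∀ ω ∈ D, s ≤ γ ω)
    {N : PathSpace d t → ℕ}
    (hN : ∀ n, MeasurableSet[filt d t s] {ω | N ω = n}) {G : ℕ → PathSpace d s → Time T}
    (hG : ∀ n, G n ∈ stoppingTimes d s) :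
    (fun ω => if ω ∈ D then G (N ω) (trunc s ω) else γ ω) ∈ stoppingTimes d t := by
  have hm := (filt d t).le s
  have hNm : Measurable N := measurable_to_countable' fun n => hm _ (hN n)
  have hNs : ∀ {ω ω' : PathSpace d t}, stopped s ω = stopped s ω' → N ω = N ω' := fun {ω ω'} e =>
    (mem_iff_of_stopped_eq (hN (N ω')) e).2 rfl
  refine mem_stoppingTimes ?_ ?_ ?_
  · refine Measurable.ite (hm _ hD) ?_ (stoppingTimes_measurable hγ)
    have hu : Measurable fun p : ℕ × PathSpace d t => G p.1 (trunc s p.2) :=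
      measurable_from_prod_countable_right fun n =>
        (stoppingTimes_measurable (hG n)).comp (measurable_trunc s)
    exact hu.comp (hNm.prodMk measurable_id)
  · intro ω
    split_ifs
    · exact hts.trans ((hG _).1 _)
    · exact hγ.1 _
  · intro r hr ω
    have er : stopped r ω = stopped r (stopped r ω) := by rw [stopped_stopped, min_self]
    rcases le_or_gt s r with hsr | hsr
    · have es : stopped s (stopped r ω) = stopped s ω := by
        rw [stopped_stopped, min_eq_left hsr]
      have hDs := mem_iff_of_stopped_eq hD es
      simp only [hNs es, hDs]
      split_ifs
      · exact comp_trunc_le_iff (hG _) ω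
      · exact stoppingTimes_le_congr hγ er
    · have key : ∀ ω, (if ω ∈ D then G (N ω) (trunc s ω) else γ ω) ≤ r ↔ γ ω ≤ r := by
        intro ω
        split_ifs with h
        · exact iff_of_false (hsr.trans_le ((hG _).1 _)).not_ge
            (hsr.trans_le (hDγ ω h)).not_ge
        · rfl
      rw [key, key]
      exact stoppingTimes_le_congr hγ er

variable [Fact (0 < T)]
  {PP : ∀ t : Time T, Set (ProbabilityMeasure (PathSpace d t))}
  {Y : Time T → Omega d T → ℝ} {wp : Omega d T → Time T} {M : ℝ} {ρ ρ₁ : ℝ → ℝ} {κ : ℝ}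

theorem setIntegral_eq_of_restrict_compl_eq {α : Type*} [MeasurableSpace α] {μ μ' : Measure α}
    {D B : Set α} (h : μ'.restrict Dᶜ = μ.restrict Dᶜ) (hB : MeasurableSet B) (hBD : B ⊆ Dᶜ)
    (f : α → ℝ) : ∫ x in B, f x ∂μ' = ∫ x in B, f x ∂μ := by
  have e : ∀ ν : Measure α, ν.restrict B = (ν.restrict Dᶜ).restrict B := fun ν => by
    rw [Measure.restrict_restrict hB, Set.inter_eq_left.2 hBD]
  rw [e μ', h, ← e μ]

/-- On an event `D ∈ ℱ^t_s` with `γ ≥ s` on `D`, the envelope at time `s` is attained up to `ε` by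
changing the probability and the stopping time on `D` only. -/
theorem IsPayoffPair.exists_paste (hY : IsPayoffPair Y wp M ρ κ)
    (hne : ∀ t, (PP t).Nonempty) (hP2 : HasMoveBounds PP) (hP4 : WeaklyStableUnderPasting PP)
    {t s : Time T} (hts : t ≤ s) (ω : Omega d T) {P : ProbabilityMeasure (PathSpace d t)}
    (hP : P ∈ PP t) {γ : PathSpace d t → Time T} (hγ : γ ∈ stoppingTimes d t)
    {D : Set (PathSpace d t)} (hD : MeasurableSet[filt d t s] D) (hDγ : ∀ ω' ∈ D, s ≤ γ ω')
    {ε : ℝ} (hε : 0 < ε) :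
    ∃ P' ∈ PP t, ∃ γ' ∈ stoppingTimes d t,
      (P' : Measure (PathSpace d t)).restrict Dᶜ = (P : Measure (PathSpace d t)).restrict Dᶜ ∧
      (∀ ω' ∉ D, γ' ω' = γ ω') ∧
      ∫ ω' in D, shift (snell PP (stopAt Y wp)) t ω s ω' ∂(P : Measure (PathSpace d t)) - ε
        ≤ ∫ ω' in D, shift (stopAt Y wp) t ω (γ' ω') ω' ∂(P' : Measure (PathSpace d t)) := by
  classical
  rcases hts.eq_or_lt with rfl | hlt
  · rcases filt_self_eq hD with rfl | rfl
    · exact ⟨P, hP, γ, hγ, rfl, fun _ _ => rfl, by simpa using hε.le⟩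
    · obtain ⟨P', hP', γ', hγ', h⟩ := exists_lt_snell hne (X := stopAt Y wp) (t := t) (ω := ω) hε
      refine ⟨P', hP', γ', hγ', by simp, fun ω' h => absurd (Set.mem_univ _) h, ?_⟩
      simp only [shift_snell_self, Measure.restrict_univ]
      simpa using h.le
  have hm := (filt d t).le s
  have hM := hY.bound_pos
  -- Budget: `4 * ε₁` on the cells (choice of a nearly optimal pair, its transfer from the centre to
  -- nearby paths, the variation of the envelope, and `ρbar δ`), and `2 * M * ε₁` on the leftover
  -- part of `D`.
  set ε₁ : ℝ := ε / (4 + 2 * M) with hε₁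
  have hε₁0 : 0 < ε₁ := by positivity
  have hsum : 4 * ε₁ + 2 * M * ε₁ = ε := by rw [hε₁]; field_simp
  set Z := snell PP (stopAt Y wp) with hZ
  set J : Omega d T → ProbabilityMeasure (PathSpace d s) → (PathSpace d s → Time T) → ℝ :=
    fun ω P γ => ∫ ω', shift (stopAt Y wp) s ω (γ ω') ω' ∂(P : Measure (PathSpace d s)) with hJ
  obtain ⟨ρbar, hρbar, hpaste⟩ := hP4 Y wp ⟨M, ρ, κ, hY⟩
  obtain ⟨x₀, hx₀, hρx⟩ := hρbar.exists_lt hε₁0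
  obtain ⟨δ, hδ0, hδx⟩ := exists_rat_btwn hx₀
  have hδ0' : 0 < δ := by exact_mod_cast hδ0
  have hρδ : ρbar δ ≤ ε₁ := (hρx δ hδ0.le hδx).le
  have hrad : ∀ ω' : PathSpace d t, ∃ q : ℚ, 0 < q ∧ q ≤ δ ∧ ∀ ω'' ∈ pathBall s (q : ℝ) ω',
      ∀ P ∈ PP s, ∀ γ ∈ stoppingTimes d s, |J (concat (Time.zero_le t) ω ω') P γ
        - J (concat (Time.zero_le t) ω ω'') P γ| ≤ ε₁ := by
    intro ω'
    obtain ⟨η, hη, h⟩ := hY.exists_abs_integral_sub_le hne hP2 s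
      (concat (Time.zero_le t) ω ω') hε₁0
    obtain ⟨q, hq0, hq⟩ := exists_rat_btwn (lt_min hη hδ0)
    refine ⟨q, by exact_mod_cast hq0, by exact_mod_cast (hq.trans_le (min_le_right _ _)).le,
      fun ω'' hω'' => h _ fun u hu => ?_⟩
    rw [concat_eval, concat_eval, add_sub_add_left_eq_sub]
    rw [pathBall_eq hts, Set.mem_preimage, Metric.mem_ball'] at hω''
    have h3 := norm_eval_sub_le_dist (stopped s ω') (stopped s ω'') u
    rw [stopped_eval, stopped_eval, min_eq_left hu] at h3
    exact h3.trans (hω''.trans (hq.trans_le (min_le_left _ _))).le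
  choose q hq0 hqδ hq using hrad
  have hopt : ∀ ω' : PathSpace d t, ∃ P ∈ PP s, ∃ γ ∈ stoppingTimes d s,
      Z s (concat (Time.zero_le t) ω ω') - ε₁ < J (concat (Time.zero_le t) ω ω') P γ :=
    fun ω' => exists_lt_snell hne hε₁0
  choose Q hQ G hG hQG using hopt
  have : Nonempty (PathSpace d t) := ⟨trunc t ω⟩
  obtain ⟨x, N, hN, hNx⟩ := exists_partition_pathBall hts (δ := fun ω' => (q ω' : ℝ))
    fun ω' => by exact_mod_cast hq0 ω'
  -- Pasting admits only finitely many cells. As `N` is finite everywhere, its tail has small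
  -- probability and joins the cell `A 0`, where nothing changes.
  have hsmall : ∃ n, (P : Measure (PathSpace d t)).real {ω' | n ≤ N ω'} ≤ ε₁ := by
    have hNm : Measurable N := measurable_to_countable' fun n => hm _ (hN n)
    have h1 : Tendsto (fun n => (P : Measure (PathSpace d t)) {ω' | n ≤ N ω'}) atTop
        (𝓝 ((P : Measure (PathSpace d t)) (⋂ n, {ω' | n ≤ N ω'}))) :=
      tendsto_measure_iInter_atTop (fun n => (hNm measurableSet_Ici).nullMeasurableSet)
        (fun a b hab ω' (h : b ≤ N ω') => hab.trans h) ⟨0, measure_ne_top _ _⟩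
    have h2 : (⋂ n, {ω' | n ≤ N ω'}) = ∅ :=
      Set.eq_empty_of_forall_notMem fun ω' h =>
        absurd (Set.mem_iInter.1 h (N ω' + 1)) (by simp)
    rw [h2, measure_empty] at h1
    obtain ⟨n, hn⟩ := (h1.eventually (gt_mem_nhds (ENNReal.ofReal_pos.2 hε₁0))).exists
    exact ⟨n, ENNReal.toReal_le_of_le_ofReal hε₁0.le hn.le⟩
  obtain ⟨lam, hlam⟩ := hsmall
  set C : Fin lam → Set (PathSpace d t) := fun j => D ∩ {ω' | N ω' = j} with hC
  set D' : Set (PathSpace d t) := D ∩ {ω' | N ω' < lam} with hD'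
  have hCm : ∀ j, MeasurableSet[filt d t s] (C j) := fun j =>
    @MeasurableSet.inter _ (filt d t s) _ _ hD (hN j)
  have hD'C : D' = ⋃ j, C j := by
    ext ω'
    simp only [hD', hC, Set.mem_inter_iff, Set.mem_ofPred_eq, Set.mem_iUnion]
    exact ⟨fun ⟨h1, h2⟩ => ⟨⟨_, h2⟩, h1, rfl⟩, fun ⟨j, h1, h2⟩ => ⟨h1, h2 ▸ j.2⟩⟩
  have hD'm : MeasurableSet[filt d t s] D' := by
    rw [hD'C]; exact @MeasurableSet.iUnion _ _ (filt d t s) _ _ hCm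
  have hCdisj : Pairwise (fun i j => Disjoint (C i) (C j)) := fun i j hij =>
    Set.disjoint_left.2 fun ω' h1 h2 => hij (Fin.ext (h1.2.symm.trans h2.2))
  set A : Fin (lam + 1) → Set (PathSpace d t) := Fin.cases D'ᶜ C with hA
  have hCA : ∀ j, Disjoint D'ᶜ (C j) := fun j =>
    (Set.disjoint_compl_left_iff_subset.2 (hD'C ▸ Set.subset_iUnion C j))
  obtain ⟨P', hP', hP0, hPj⟩ := hpaste t s hlt ω P hP δ hδ0' lam A
    (by
      refine Fin.cases ?_ fun j => ?_
      · exact @MeasurableSet.compl _ _ (filt d t s) hD'm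
      · exact hCm j)
    (by
      intro i j
      refine Fin.cases ?_ (fun i => ?_) i <;> refine Fin.cases ?_ (fun j => ?_) j
      · exact fun h => absurd rfl h
      · exact fun _ => hCA j
      · exact fun _ => (hCA i).symm
      · exact fun h => hCdisj fun e => h (congrArg _ e))
    (by
      refine Set.eq_univ_of_forall fun ω' => Set.mem_iUnion.2 ?_
      by_cases h : ω' ∈ D'
      · rw [hD'C] at h
        obtain ⟨j, hj⟩ := Set.mem_iUnion.1 h
        exact ⟨j.succ, hj⟩
      · exact ⟨0, h⟩)
    (fun j => ⟨q (x j), hq0 _, hqδ _, x j, fun ω' h => by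
      have := hNx ω'
      rwa [show N ω' = j from h.2] at this⟩)
    (fun j => Q (x j)) (fun j => hQ _)
  set γ' : PathSpace d t → Time T := fun ω' =>
    if ω' ∈ D' then G (x (N ω')) (trunc s ω') else γ ω' with hγ'
  have hγ'mem : γ' ∈ stoppingTimes d t :=
    paste_mem_stoppingTimes hγ hts hD'm (fun ω' h => hDγ ω' h.1) hN
      (G := fun n => G (x n)) fun n => hG _
  have hXi := fun P : ProbabilityMeasure (PathSpace d t) =>
    hY.integrable_shift ω (stoppingTimes_measurable hγ'mem) P
  have hZi := hY.integrable_shift_snell hne hP2 s ω P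
  refine ⟨P', hP', γ', hγ'mem, ?_, fun ω' h => if_neg fun h' => h h'.1, ?_⟩
  · ext B hB
    rw [Measure.restrict_apply hB, Measure.restrict_apply hB]
    have := hP0 (B ∩ Dᶜ) (hB.inter (hm _ hD).compl)
    rwa [Set.inter_eq_left.2
      (show B ∩ Dᶜ ⊆ A 0 from fun ω' h h' => h.2 h'.1)] at this
  have hcell : ∀ j : Fin lam, ∫ ω' in C j, (shift Z t ω s ω' - 4 * ε₁)
        ∂(P : Measure (PathSpace d t))
      ≤ ∫ ω' in C j, shift (stopAt Y wp) t ω (γ' ω') ω' ∂(P' : Measure (PathSpace d t)) := by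
    intro j
    have h1 := ((hPj j Set.univ MeasurableSet.univ).2 _ (hG (x j)))
    have eA : A j.succ = C j := rfl
    rw [Set.univ_inter, eA] at h1
    have h2 : ∫ ω' in C j, shift (stopAt Y wp) t ω (γ' ω') ω' ∂(P' : Measure (PathSpace d t))
        = ∫ ω' in C j, shift (stopAt Y wp) t ω (G (x j) (trunc s ω')) ω'
          ∂(P' : Measure (PathSpace d t)) :=
      setIntegral_congr_fun (hm _ (hCm j)) fun ω' h => by
        have h3 : ω' ∈ D' := by rw [hD'C]; exact Set.mem_iUnion.2 ⟨j, h⟩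
        have h4 : γ' ω' = G (x j) (trunc s ω') := by
          rw [hγ']; dsimp only; rw [if_pos h3, show N ω' = j from h.2]
        rw [h4]
    rw [h2]
    refine le_trans ?_ h1
    have hJm : Integrable (fun ω' => J (concat (Time.zero_le t) ω ω') (Q (x j)) (G (x j)))
        (P : Measure (PathSpace d t)) := by
      refine Integrable.of_bound ?_ M (ae_of_all _ fun _ => hY.abs_integral_shift_le _ _ _)
      have hmeas : Measurable fun p : PathSpace d t × PathSpace d s =>
          shift (stopAt Y wp) s (concat (Time.zero_le t) ω p.1) (G (x j) p.2) p.2 := by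
        refine hY.continuous_stopAt.measurable.comp
          (((stoppingTimes_measurable (hG (x j))).comp measurable_snd).prodMk ?_)
        exact (continuous_concat (Time.zero_le s)).measurable.comp
          (((measurable_concat_right (Time.zero_le t) ω).comp measurable_fst).prodMk
            measurable_snd)
      exact (hmeas.stronglyMeasurable.integral_prod_right
        (ν := (Q (x j) : Measure (PathSpace d s)))).aestronglyMeasurable
    refine setIntegral_mono_on (hZi.sub (integrable_const _)).integrableOn
      (hJm.sub (integrable_const _)).integrableOn (hm _ (hCm j)) fun ω' h => ?_
    have hb : ω' ∈ pathBall s (q (x j) : ℝ) (x j) := by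
      have := hNx ω'
      rwa [show N ω' = j from h.2] at this
    have h5 := hq (x j) ω' hb
    have h6 := (abs_le.1 (h5 _ (hQ (x j)) _ (hG (x j)))).2
    have h7 := (abs_le.1 (hY.abs_snell_sub_le hne h5)).1
    have h8 := hQG (x j)
    change Z s (concat (Time.zero_le t) ω ω') - 4 * ε₁ ≤
      J (concat (Time.zero_le t) ω ω') (Q (x j)) (G (x j)) - ρbar δ
    linarith
  have hDsplit : ∀ (ν : ProbabilityMeasure (PathSpace d t)) (f : PathSpace d t → ℝ),
      Integrable f (ν : Measure (PathSpace d t)) →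
      ∫ ω' in D, f ω' ∂(ν : Measure (PathSpace d t))
        = ∫ ω' in D \ D', f ω' ∂(ν : Measure (PathSpace d t))
          + ∑ j, ∫ ω' in C j, f ω' ∂(ν : Measure (PathSpace d t)) := by
    intro ν f hf
    have h1 := integral_iUnion_fintype (μ := (ν : Measure (PathSpace d t))) (f := f)
      (fun j => hm _ (hCm j)) hCdisj fun j => hf.integrableOn
    rw [← h1, ← hD'C, add_comm, ← integral_inter_add_sdiff (hm _ hD'm) hf.integrableOn,
      Set.inter_eq_right.2 (show D' ⊆ D from Set.inter_subset_left)]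
  -- The leftover part lies in `A 0`, so `P'` gives it the same small mass as `P`; there both
  -- integrands are bounded by `M`.
  have hR : (P' : Measure (PathSpace d t)).real (D \ D')
      = (P : Measure (PathSpace d t)).real (D \ D') := by
    have := hP0 (D \ D') ((hm _ hD).diff (hm _ hD'm))
    rw [Set.inter_eq_left.2 (show D \ D' ⊆ A 0 from fun ω' h => h.2)] at this
    exact congrArg ENNReal.toReal this
  have hRsub : D \ D' ⊆ {ω' | lam ≤ N ω'} := fun ω' h => by
    change lam ≤ N ω'
    exact not_lt.1 fun h' => h.2 ⟨h.1, h'⟩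
  have hRs : (P : Measure (PathSpace d t)).real (D \ D') ≤ ε₁ :=
    (measureReal_mono hRsub).trans hlam
  have hbX := norm_setIntegral_le_of_norm_le_const (μ := (P' : Measure (PathSpace d t)))
    (s := D \ D') (C := M) (f := fun ω' => shift (stopAt Y wp) t ω (γ' ω') ω')
    (measure_lt_top _ _) fun ω' _ => hY.abs_stopAt_le _ _
  have hbZ := norm_setIntegral_le_of_norm_le_const (μ := (P : Measure (PathSpace d t)))
    (s := D \ D') (C := M) (f := fun ω' => shift Z t ω s ω' - 4 * ε₁ + 4 * ε₁)
    (measure_lt_top _ _) fun ω' _ => by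
      rw [sub_add_cancel]; exact hY.abs_snell_le hne _ _
  simp only [sub_add_cancel] at hbZ
  rw [hR, Real.norm_eq_abs] at hbX
  rw [Real.norm_eq_abs] at hbZ
  have hMR := mul_le_mul_of_nonneg_left hRs hM.le
  have hcells := Finset.sum_le_sum fun j (_ : j ∈ Finset.univ) => hcell j
  have hconst : ∫ ω' in D', (4 * ε₁) ∂(P : Measure (PathSpace d t)) ≤ 4 * ε₁ := by
    rw [setIntegral_const, smul_eq_mul]
    exact mul_le_of_le_one_left (by positivity) measureReal_le_one
  have hcells' : ∑ j, ∫ ω' in C j, (shift Z t ω s ω' - 4 * ε₁) ∂(P : Measure (PathSpace d t))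
      = ∑ j, ∫ ω' in C j, shift Z t ω s ω' ∂(P : Measure (PathSpace d t))
        - ∫ ω' in D', (4 * ε₁) ∂(P : Measure (PathSpace d t)) := by
    rw [hD'C, integral_iUnion_fintype (fun j => hm _ (hCm j)) hCdisj
      fun j => integrableOn_const, ← Finset.sum_sub_distrib]
    exact Finset.sum_congr rfl fun j _ =>
      integral_sub hZi.integrableOn integrableOn_const
  rw [hDsplit P _ hZi, hDsplit P' _ (hXi P')]
  linarith [(abs_le.1 hbX).1, (abs_le.1 hbZ).2]

/-- Replacing the payoff by the envelope on finitely many disjoint events does not increase the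
value. -/
theorem IsPayoffPair.setIntegral_add_sum_le (hY : IsPayoffPair Y wp M ρ κ)
    (hne : ∀ t, (PP t).Nonempty) (hP2 : HasMoveBounds PP) (hP4 : WeaklyStableUnderPasting PP)
    {t : Time T} (ω : Omega d T) {ι : Type*} (I : Finset ι) {s : ι → Time T}
    (hs : ∀ i, t ≤ s i) {D : ι → Set (PathSpace d t)}
    (hD : ∀ i, MeasurableSet[filt d t (s i)] (D i))
    (hdisj : Pairwise fun i j => Disjoint (D i) (D j))
    {P : ProbabilityMeasure (PathSpace d t)} (hP : P ∈ PP t) {γ : PathSpace d t → Time T}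
    (hγ : γ ∈ stoppingTimes d t) (hDγ : ∀ i ∈ I, ∀ ω' ∈ D i, s i ≤ γ ω') :
    ∫ ω' in (⋃ i ∈ I, D i)ᶜ, shift (stopAt Y wp) t ω (γ ω') ω' ∂(P : Measure (PathSpace d t))
      + ∑ i ∈ I, ∫ ω' in D i, shift (snell PP (stopAt Y wp)) t ω (s i) ω'
          ∂(P : Measure (PathSpace d t))
      ≤ snell PP (stopAt Y wp) t ω := by
  classical
  have hDm : ∀ i, MeasurableSet (D i) := fun i => (filt d t).le _ _ (hD i)
  -- `P` and `γ` must vary, because each pasting replaces them. The times `s i` need no order: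
  -- pasting on `D a` leaves the measure and the stopping time on the other events untouched.
  induction I using Finset.induction_on generalizing P γ with
  | empty => simpa using hY.le_snell ω hP hγ
  | insert a I ha ih =>
    refine le_of_forall_pos_le_add fun ε hε => ?_
    obtain ⟨P', hP', γ', hγ', hres, heq, hle⟩ := hY.exists_paste hne hP2 hP4 (hs a) ω hP hγ (hD a)
      (hDγ a (Finset.mem_insert_self _ _)) hε
    have hsub : ∀ i ∈ I, D i ⊆ (D a)ᶜ := fun i hi =>
      (Set.disjoint_left.1 (hdisj (show i ≠ a from fun e => ha (e ▸ hi))))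
    have hI := ih hP' hγ' fun i hi ω' hω' => by
      rw [heq ω' (hsub i hi hω')]
      exact hDγ i (Finset.mem_insert_of_mem hi) ω' hω'
    have hUm : MeasurableSet (⋃ i ∈ I, D i)ᶜ :=
      (Finset.measurableSet_biUnion I fun i _ => hDm i).compl
    have hU'm : MeasurableSet (⋃ i ∈ insert a I, D i)ᶜ :=
      (Finset.measurableSet_biUnion _ fun i _ => hDm i).compl
    have hXi := hY.integrable_shift ω (stoppingTimes_measurable hγ') P'
    have e1 : (⋃ i ∈ I, D i)ᶜ ∩ D a = D a := Set.inter_eq_right.2 fun ω' h h' => by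
      obtain ⟨i, hi, hi'⟩ := Set.mem_iUnion₂.1 h'
      exact hsub i hi hi' h
    have e2 : (⋃ i ∈ I, D i)ᶜ \ D a = (⋃ i ∈ insert a I, D i)ᶜ := by
      rw [Finset.set_biUnion_insert, Set.compl_union, Set.sdiff_eq, Set.inter_comm]
    have hU'sub : (⋃ i ∈ insert a I, D i)ᶜ ⊆ (D a)ᶜ := by
      rw [← e2]; exact fun ω' h => h.2
    have e3 : ∫ ω' in (⋃ i ∈ insert a I, D i)ᶜ, shift (stopAt Y wp) t ω (γ' ω') ω'
          ∂(P' : Measure (PathSpace d t))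
        = ∫ ω' in (⋃ i ∈ insert a I, D i)ᶜ, shift (stopAt Y wp) t ω (γ ω') ω'
          ∂(P : Measure (PathSpace d t)) := by
      rw [setIntegral_eq_of_restrict_compl_eq hres hU'm hU'sub]
      exact setIntegral_congr_fun hU'm fun ω' h => by
        rw [heq ω' (hU'sub h)]
    have e4 : ∑ i ∈ I, ∫ ω' in D i, shift (snell PP (stopAt Y wp)) t ω (s i) ω'
          ∂(P' : Measure (PathSpace d t))
        = ∑ i ∈ I, ∫ ω' in D i, shift (snell PP (stopAt Y wp)) t ω (s i) ω'
          ∂(P : Measure (PathSpace d t)) :=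
      Finset.sum_congr rfl fun i hi =>
        setIntegral_eq_of_restrict_compl_eq hres (hDm i) (hsub i hi) _
    rw [← integral_inter_add_sdiff (hDm a) hXi.integrableOn, e1, e2, e3, e4] at hI
    rw [Finset.sum_insert ha]
    linarith

end SnellEnvelope

namespace SnellEnvelope

variable {d : ℕ} {T : ℝ} [Fact (0 < T)]
  {PP : ∀ t : Time T, Set (ProbabilityMeasure (PathSpace d t))}
  {Y : Time T → Omega d T → ℝ} {wp : Omega d T → Time T} {M : ℝ} {ρ ρ₁ : ℝ → ℝ} {κ : ℝ}

/-! ### Continuity of the envelope in time -/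

theorem IsPayoffPair.integral_shift_snell_le (hY : IsPayoffPair Y wp M ρ κ)
    (hne : ∀ t, (PP t).Nonempty) (hP2 : HasMoveBounds PP) (hP4 : WeaklyStableUnderPasting PP)
    {t s : Time T} (hts : t ≤ s) (ω : Omega d T) {P : ProbabilityMeasure (PathSpace d t)}
    (hP : P ∈ PP t) :
    ∫ ω', shift (snell PP (stopAt Y wp)) t ω s ω' ∂(P : Measure (PathSpace d t))
      ≤ snell PP (stopAt Y wp) t ω := by
  have h := hY.setIntegral_add_sum_le hne hP2 hP4 ω (Finset.univ : Finset Unit) (s := fun _ => s)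
    (fun _ => hts) (D := fun _ => Set.univ) (fun _ => @MeasurableSet.univ _ (filt d t s))
    (fun i j h => absurd rfl h) hP (const_mem_stoppingTimes hts) (fun _ _ _ _ => le_rfl)
  have e : (⋃ i ∈ (Finset.univ : Finset Unit), (Set.univ : Set (PathSpace d t)))ᶜ = ∅ := by
    rw [Set.compl_empty_iff]
    exact Set.eq_univ_of_forall fun ω' => Set.mem_iUnion₂.2 ⟨(), Finset.mem_univ _, trivial⟩
  rw [e] at h
  simpa using h

/-- On `{γ ≥ s}` conditioning bounds the payoff by `Z_s`. On `{γ < s}` the payoff is within one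
increment of `Ŷ_s ≤ Z_s`, and `γ ∧ s` is at distance at most `s - t` from `s`, so `ρ₁(s - t)` bounds
the expected increment. -/
theorem IsPayoffPair.integral_shift_le_add (hY : IsPayoffPair Y wp M ρ κ)
    (hne : ∀ t, (PP t).Nonempty) (hP2 : HasMoveBounds PP) (hP3 : ShiftInvariant PP)
    (hρ₁ : IsModulus ρ₁) (hB : MoveBound PP ρ ρ₁)
    {t s : Time T} (hts : t < s) (ω : Omega d T) {P : ProbabilityMeasure (PathSpace d t)}
    (hP : P ∈ PP t) {γ : PathSpace d t → Time T} (hγ : γ ∈ stoppingTimes d t) :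
    ∫ ω', shift (stopAt Y wp) t ω (γ ω') ω' ∂(P : Measure (PathSpace d t))
      ≤ ∫ ω', shift (snell PP (stopAt Y wp)) t ω s ω' ∂(P : Measure (PathSpace d t))
        + ρ₁ ((s : ℝ) - t) := by
  have hγm := stoppingTimes_measurable hγ
  set D : Set (PathSpace d t) := {ω' | s ≤ γ ω'} with hD
  have hDm : MeasurableSet D := hγm measurableSet_Ici
  have hDf : MeasurableSet[filt d t s] D := measurableSet_filt_of_stopped hDm fun ω' => by
    have := stoppingTimes_lt_congr hγ (r := s) (ω := ω') (ω' := stopped s ω')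
      (by rw [stopped_stopped, min_self])
    change s ≤ γ ω' ↔ s ≤ γ (stopped s ω')
    rw [← not_lt, ← not_lt, this]
  have hmin := min_mem_stoppingTimes hγ (const_mem_stoppingTimes hts.le)
  have hXi := hY.integrable_shift ω hγm P
  have hZi := hY.integrable_shift_snell hne hP2 s ω P
  have hXmin := hY.integrable_shift ω (stoppingTimes_measurable hmin) P
  have hXs := hY.integrable_shift ω (measurable_const (a := s)) P
  have hdi : Integrable (fun ω' => |shift (stopAt Y wp) t ω (min (γ ω') s) ω'
      - shift (stopAt Y wp) t ω s ω'|) (P : Measure (PathSpace d t)) := (hXmin.sub hXs).abs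
  have hst : (t : ℝ) < s := hts
  have hosc := hB.integral_le hne hY.isModulus hρ₁ (sub_pos.2 hst) hP hmin (hXmin.sub hXs)
    fun ω' => hY.stopAt_sub_stopAt_le ω ω' (hmin.1 ω') (min_le_right _ _) (by
      have : (t : ℝ) ≤ (min (γ ω') s : Time T) := hmin.1 ω'
      linarith)
  have h1 := hY.setIntegral_shift_le hne hP2 hP3 hts.le ω hP hγ hDf fun ω' h => h
  have h2 : ∫ ω' in Dᶜ, shift (stopAt Y wp) t ω (γ ω') ω' ∂(P : Measure (PathSpace d t))
      ≤ ∫ ω' in Dᶜ, (shift (snell PP (stopAt Y wp)) t ω s ω'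
        + |shift (stopAt Y wp) t ω (min (γ ω') s) ω' - shift (stopAt Y wp) t ω s ω'|)
        ∂(P : Measure (PathSpace d t)) := by
    refine setIntegral_mono_on hXi.integrableOn (hZi.add hdi).integrableOn
      hDm.compl fun ω' h => ?_
    have h3 : γ ω' < s := not_le.1 h
    rw [min_eq_left h3.le]
    have h4 : shift (stopAt Y wp) t ω s ω' ≤ shift (snell PP (stopAt Y wp)) t ω s ω' :=
      hY.stopAt_le_snell hne _ _
    linarith [le_abs_self (shift (stopAt Y wp) t ω (γ ω') ω' - shift (stopAt Y wp) t ω s ω')]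
  have h5 : ∫ ω' in Dᶜ, |shift (stopAt Y wp) t ω (min (γ ω') s) ω'
        - shift (stopAt Y wp) t ω s ω'| ∂(P : Measure (PathSpace d t)) ≤ ρ₁ ((s : ℝ) - t) :=
    (setIntegral_le_integral hdi (ae_of_all _ fun _ => abs_nonneg _)).trans hosc
  rw [integral_add hZi.integrableOn hdi.integrableOn] at h2
  rw [← integral_add_compl hDm hXi, ← integral_add_compl hDm hZi]
  linarith

/-- Comparison of the envelope at time `s` along `ω` and along a path that leaves `ω` at time `t`,
when the payoff is not yet stopped at time `t`. -/
theorem IsPayoffPair.abs_shift_snell_sub_le (hY : IsPayoffPair Y wp M ρ κ)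
    (hne : ∀ t, (PP t).Nonempty) (hρ₁ : IsModulus ρ₁) (hB : MoveBound PP ρ ρ₁)
    {t s : Time T} (hts : t ≤ s) {ω : Omega d T} (hw : t < wp ω) {a : ℝ} (ha : 0 < a)
    {ω' : PathSpace d t} (hω' : ∀ u, t ≤ u → u ≤ s → ‖ω' u‖ ≤ a) :
    |shift (snell PP (stopAt Y wp)) t ω s ω' - snell PP (stopAt Y wp) s ω|
      ≤ ρ₁ ((1 + κ) * (a + oscOn t s ω)) := by
  have hκ := hY.lipschitz_pos
  have ho := oscOn_nonneg t s ω
  set D := a + oscOn t s ω with hD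
  have hD0 : 0 < D := by positivity
  have e : (1 + κ) * D = κ * D + D := by ring
  -- The event `{wp ≤ t}` is decided by the path up to `t`, so `wp` exceeds `t` on all continuations
  -- at once. Only times in `[t, s]` are then compared, which is why the oscillation on `[t, s]`
  -- suffices.
  have hwle : ∀ {ω₂ : Omega d T}, stopped t ω₂ = stopped t ω → t ≤ wp ω₂ := fun {ω₂} h =>
    (not_le.1 fun h' => not_le.2 hw ((stoppingTimes_le_congr hY.stopping h).1 h')).le
  have h₁ : ∀ u v : Time T, t ≤ u → t ≤ v → u ≤ s → v ≤ s →
      ‖ω u - (concat (Time.zero_le t) ω ω') v‖ ≤ D := by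
    intro u v hu hv hus hvs
    rw [concat_eval, min_eq_right hv]
    have e : ω u - (ω t + ω' v) = (ω u - ω t) - ω' v := by abel
    rw [e, hD, add_comm a]
    exact (norm_sub_le _ _).trans (add_le_add (le_oscOn ω le_rfl hu hus) (hω' v hv hvs))
  rw [e, abs_sub_comm]
  refine hY.abs_snell_sub_le hne fun P hP γ hγ => hY.abs_integral_sub_le hB hne hρ₁ (t₀ := t)
    hD0.le le_rfl (by positivity) (fun u hu => ?_) (fun u v h1 h2 h3 h4 _ => h₁ u v h1 h2 h3 h4)
    hts (fun ω'' => hwle (stopped_concat_of_le _ hts _ _)) (fun ω'' => hwle ?_) hP hγ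
  · rcases le_total t u with h | h
    · exact h₁ u u h h hu hu
    · rw [concat_eval, min_eq_left h, eval_of_le ω' h, add_zero, sub_self, norm_zero]
      exact hD0.le
  · rw [stopped_concat_of_le _ hts, stopped_concat_of_le _ le_rfl]

theorem IsPayoffPair.snell_eq_of_wp_le (hY : IsPayoffPair Y wp M ρ κ)
    (hne : ∀ t, (PP t).Nonempty) {t : Time T} {ω : Omega d T} (hw : wp ω ≤ t) :
    snell PP (stopAt Y wp) t ω = Y (wp ω) ω := by
  have h : ∀ (P : ProbabilityMeasure (PathSpace d t)), ∀ γ ∈ stoppingTimes d t,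
      ∫ ω', shift (stopAt Y wp) t ω (γ ω') ω' ∂(P : Measure (PathSpace d t)) = Y (wp ω) ω := by
    intro P γ hγ
    simp only [fun ω' => hY.shift_eq_of_wp_le hw (hγ.1 ω') ω']
    simp
  obtain ⟨P, hP⟩ := hne t
  refine le_antisymm (snell_le hne fun P _ γ hγ => (h P γ hγ).le) ?_
  rw [← h P _ (const_mem_stoppingTimes le_rfl)]
  exact hY.le_snell ω hP (const_mem_stoppingTimes le_rfl)

/-- The expected deviation of the envelope at time `s`. -/
theorem IsPayoffPair.integral_abs_shift_snell_sub_le (hY : IsPayoffPair Y wp M ρ κ)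
    (hne : ∀ t, (PP t).Nonempty) (hP2 : HasMoveBounds PP)
    (hρ₁ : IsModulus ρ₁) (hB : MoveBound PP ρ ρ₁) {ϱ : ℝ → ℝ} (hϱ : IsModulus ϱ)
    (hBϱ : MoveBound PP (fun x => x) ϱ) {t s : Time T} (hts : t < s) {ω : Omega d T}
    (hw : t < wp ω) {a : ℝ} (ha : 0 < a) {P : ProbabilityMeasure (PathSpace d t)} (hP : P ∈ PP t) :
    ∫ ω', |shift (snell PP (stopAt Y wp)) t ω s ω' - snell PP (stopAt Y wp) s ω|
        ∂(P : Measure (PathSpace d t))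
      ≤ ρ₁ ((1 + κ) * (a + oscOn t s ω)) + 2 * M / a * ϱ ((s : ℝ) - t) := by
  have hM := hY.bound_pos
  have hκ := hY.lipschitz_pos
  have hst : (t : ℝ) < s := hts
  have hh : 0 < (s : ℝ) - t := sub_pos.2 hst
  have htT : (t : ℝ) < T := hst.trans_le s.2.2
  have ho := oscOn_nonneg t s ω
  set c := ρ₁ ((1 + κ) * (a + oscOn t s ω)) with hc
  have hc0 : 0 ≤ c := hρ₁.1 _ (by positivity)
  have hϱ0 := hϱ.1 _ hh.le
  set g : PathSpace d t → ℝ := fun ω' =>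
    |shift (snell PP (stopAt Y wp)) t ω s ω' - snell PP (stopAt Y wp) s ω| with hg
  have hgm : Measurable g :=
    ((hY.continuous_shift_snell hne hP2 s ω).sub continuous_const).abs.measurable
  -- A pathwise Markov inequality: if the oscillation exceeds `a`, the trivial bound `2 * M` is at
  -- most `2 * M / a` times the oscillation.
  have hpt : ∀ ω', g ω' ≤ c + 2 * M / a * (((s : ℝ) - t) + oscAfter t ((s : ℝ) - t) ω') := by
    intro ω'
    have hosc := oscAfter_nonneg t ((s : ℝ) - t) ω'
    by_cases h : oscAfter t ((s : ℝ) - t) ω' ≤ a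
    · refine (hY.abs_shift_snell_sub_le hne hρ₁ hB hts.le hw ha fun u hu hus => ?_).trans
        (le_add_of_nonneg_right (by positivity))
      have h1 := le_oscAfter ω' hu (δ := (s : ℝ) - t) (by
        have : (u : ℝ) ≤ s := hus
        linarith)
      rw [eval_of_le ω' le_rfl, sub_zero] at h1
      exact h1.trans h
    · have h1 : g ω' ≤ M + M := (abs_sub _ _).trans
        (add_le_add (hY.abs_snell_le hne _ _) (hY.abs_snell_le hne _ _))
      have h2 : 2 * M / a * a ≤ 2 * M / a * (((s : ℝ) - t) + oscAfter t ((s : ℝ) - t) ω') := by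
        gcongr
        linarith [not_le.1 h]
      rw [div_mul_cancel₀ _ ha.ne'] at h2
      linarith
  -- The move bound is stated for `lintegral`, so no measurability of the oscillation has to be
  -- established.
  rw [integral_eq_lintegral_of_nonneg_ae (ae_of_all _ fun _ => abs_nonneg _)
    hgm.aestronglyMeasurable]
  refine ENNReal.toReal_le_of_le_ofReal (by positivity) ?_
  have hk : 0 ≤ 2 * M / a := by positivity
  calc ∫⁻ ω', ENNReal.ofReal (g ω') ∂(P : Measure (PathSpace d t))
      ≤ ∫⁻ ω', (ENNReal.ofReal c + ENNReal.ofReal (2 * M / a) *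
          ENNReal.ofReal (((s : ℝ) - t) + oscAfter t ((s : ℝ) - t) ω'))
          ∂(P : Measure (PathSpace d t)) := lintegral_mono fun ω' => by
        have hosc := oscAfter_nonneg t ((s : ℝ) - t) ω'
        rw [← ENNReal.ofReal_mul hk, ← ENNReal.ofReal_add hc0 (by positivity)]
        exact ENNReal.ofReal_le_ofReal (hpt ω')
    _ = ENNReal.ofReal c + ENNReal.ofReal (2 * M / a) *
          ∫⁻ ω', ENNReal.ofReal (((s : ℝ) - t) + oscAfter t ((s : ℝ) - t) ω')
          ∂(P : Measure (PathSpace d t)) := by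
        rw [lintegral_add_left measurable_const, lintegral_const_mul' _ _ ENNReal.ofReal_ne_top]
        simp
    _ ≤ ENNReal.ofReal c + ENNReal.ofReal (2 * M / a) * ENNReal.ofReal (ϱ ((s : ℝ) - t)) := by
        gcongr
        exact hBϱ t htT _ hh P hP _ (const_mem_stoppingTimes le_rfl)
    _ = _ := by
        rw [← ENNReal.ofReal_mul hk, ← ENNReal.ofReal_add hc0 (by positivity)]

theorem IsPayoffPair.deltaTS_nonneg (hY : IsPayoffPair Y wp M ρ κ) {t s : Time T} (h : t ≤ s)
    (q : ℝ) (ω : Omega d T) : 0 ≤ deltaTS κ q t s ω := by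
  have hκ := hY.lipschitz_pos
  have hst : (t : ℝ) ≤ s := h
  exact mul_nonneg (by positivity)
    (add_nonneg (Real.rpow_nonneg (sub_nonneg.2 hst) _) (oscOn_nonneg _ _ _))

/-- The path continuity estimate of the envelope. -/
theorem IsPayoffPair.abs_snell_sub_snell_le (hY : IsPayoffPair Y wp M ρ κ)
    (hne : ∀ t, (PP t).Nonempty) (hP2 : HasMoveBounds PP) (hP3 : ShiftInvariant PP)
    (hP4 : WeaklyStableUnderPasting PP) (hρ₁ : IsModulus ρ₁) (hB : MoveBound PP ρ ρ₁)
    {ϱ : ℝ → ℝ} (hϱ : IsModulus ϱ) (hBϱ : MoveBound PP (fun x => x) ϱ) {C q₁ q₂ : ℝ}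
    (hC : 0 < C) (hpow : PowerBound ϱ C q₁ q₂) (ω : Omega d T) {t s : Time T} (hts : t ≤ s) :
    |snell PP (stopAt Y wp) t ω - snell PP (stopAt Y wp) s ω| ≤
      2 * C * M * max (((s : ℝ) - t) ^ (q₁ / 2)) (((s : ℝ) - t) ^ (q₂ - q₁ / 2))
        + ρ₁ ((s : ℝ) - t) + ρ₁ (deltaTS κ q₁ t s ω) := by
  have hM := hY.bound_pos
  have hst : (t : ℝ) ≤ s := hts
  have hmax : 0 ≤ max (((s : ℝ) - t) ^ (q₁ / 2)) (((s : ℝ) - t) ^ (q₂ - q₁ / 2)) :=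
    le_max_of_le_left (Real.rpow_nonneg (sub_nonneg.2 hst) _)
  have hr1 := hρ₁.1 _ (sub_nonneg.2 hst)
  have hr2 := hρ₁.1 _ (hY.deltaTS_nonneg hts q₁ ω)
  have hRHS : 0 ≤ 2 * C * M * max (((s : ℝ) - t) ^ (q₁ / 2)) (((s : ℝ) - t) ^ (q₂ - q₁ / 2))
        + ρ₁ ((s : ℝ) - t) + ρ₁ (deltaTS κ q₁ t s ω) := by positivity
  rcases hts.eq_or_lt with rfl | hlt
  · rwa [sub_self, abs_zero]
  -- If the payoff is already frozen at `t`, the envelope equals `Y (wp ω) ω` at both times.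
  rcases le_or_gt (wp ω) t with hw | hw
  · rwa [hY.snell_eq_of_wp_le hne hw, hY.snell_eq_of_wp_le hne (hw.trans hts), sub_self, abs_zero]
  have hlt' : (t : ℝ) < s := hlt
  have hh : 0 < (s : ℝ) - t := sub_pos.2 hlt'
  set h := (s : ℝ) - t with hhdef
  have hdev : ∀ P ∈ PP t,
      |∫ ω', shift (snell PP (stopAt Y wp)) t ω s ω' ∂(P : Measure (PathSpace d t))
        - snell PP (stopAt Y wp) s ω|
      ≤ ρ₁ (deltaTS κ q₁ t s ω) + 2 * C * M * max (h ^ (q₁ / 2)) (h ^ (q₂ - q₁ / 2)) := by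
    intro P hP
    have hi := hY.integrable_shift_snell hne hP2 s ω P
    have e1 : ∫ ω', shift (snell PP (stopAt Y wp)) t ω s ω' ∂(P : Measure (PathSpace d t))
        - snell PP (stopAt Y wp) s ω
        = ∫ ω', (shift (snell PP (stopAt Y wp)) t ω s ω' - snell PP (stopAt Y wp) s ω)
          ∂(P : Measure (PathSpace d t)) := by
      rw [integral_sub hi (integrable_const _)]; simp
    rw [e1]
    refine abs_integral_le_integral_abs.trans ?_
    have ha : 0 < h ^ (q₁ / 2) := Real.rpow_pos_of_pos hh _
    refine (hY.integral_abs_shift_snell_sub_le hne hP2 hρ₁ hB hϱ hBϱ hlt hw ha hP).trans ?_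
    refine add_le_add le_rfl ?_
    -- The threshold `a = h ^ (q₁ / 2)` is half of the smaller power: dividing `ϱ h` by it leaves
    -- the exponents `q₁ / 2` and `q₂ - q₁ / 2`, both positive when `0 < q₁ ≤ q₂`.
    have e2 : max (h ^ q₁) (h ^ q₂)
        = h ^ (q₁ / 2) * max (h ^ (q₁ / 2)) (h ^ (q₂ - q₁ / 2)) := by
      rw [mul_max_of_nonneg _ _ ha.le, ← Real.rpow_add hh, ← Real.rpow_add hh]
      congr 2 <;> ring
    calc 2 * M / h ^ (q₁ / 2) * ϱ h ≤ 2 * M / h ^ (q₁ / 2) * (C * max (h ^ q₁) (h ^ q₂)) := by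
          gcongr
          exact hpow h hh.le
      _ = _ := by rw [e2]; field_simp
  have hup : snell PP (stopAt Y wp) t ω ≤ snell PP (stopAt Y wp) s ω
      + (ρ₁ (deltaTS κ q₁ t s ω) + 2 * C * M * max (h ^ (q₁ / 2)) (h ^ (q₂ - q₁ / 2)))
      + ρ₁ h := snell_le hne fun P hP γ hγ => by
    have := hY.integral_shift_le_add hne hP2 hP3 hρ₁ hB hlt ω hP hγ
    linarith [(abs_le.1 (hdev P hP)).2]
  obtain ⟨P, hP⟩ := hne t
  have hlow := hY.integral_shift_snell_le hne hP2 hP4 hts ω hP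
  have := (abs_le.1 (hdev P hP)).1
  rw [abs_le]
  constructor <;> linarith

theorem id_mem_modulusClass : (fun x : ℝ => x) ∈ modulusClass := by
  refine ⟨⟨fun x hx => hx, monotone_id.monotoneOn _, ?_⟩, 1, 1, 1, one_pos, one_pos, le_rfl,
    fun x hx => by simp⟩
  exact tendsto_id.mono_left nhdsWithin_le_nhds

/-- The paths of the envelope are continuous. -/
theorem IsPayoffPair.continuous_snell_path (hY : IsPayoffPair Y wp M ρ κ)
    (hne : ∀ t, (PP t).Nonempty) (hP2 : HasMoveBounds PP) (hP3 : ShiftInvariant PP)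
    (hP4 : WeaklyStableUnderPasting PP) (ω : Omega d T) :
    Continuous fun t : Time T => snell PP (stopAt Y wp) t ω := by
  obtain ⟨ρ₁, hρ₁, hB⟩ := hP2 ρ hY.modulus_mem
  obtain ⟨ϱ, hϱ, hBϱ⟩ := hP2 _ id_mem_modulusClass
  obtain ⟨hϱm, C, q₁, q₂, hC, hq₁, hq, hpow⟩ := hϱ
  have hκ := hY.lipschitz_pos
  refine (Metric.uniformContinuous_iff.2 fun ε hε => ?_).continuous
  have hε3 : 0 < ε / 3 := by positivity
  obtain ⟨x₀, hx₀, hx⟩ := hρ₁.1.exists_lt hε3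
  -- Chosen so that `(1 + κ) * (c + c) = x₀`, with one `c` for the power of `s - t` and one for the
  -- oscillation.
  set c := x₀ / (2 * (1 + κ)) with hc
  have hc0 : 0 < c := by positivity
  obtain ⟨h₁, hh₁, hω⟩ := exists_modulus_path ω (half_pos hc0)
  have hrpow : ∀ q : ℝ, 0 < q → Tendsto (fun h : ℝ => h ^ q) (𝓝 0) (𝓝 0) := fun q hq => by
    have := (Real.continuousAt_rpow_const 0 q (Or.inr hq.le)).tendsto
    rwa [Real.zero_rpow hq.ne'] at this
  have hT1 : Tendsto (fun h : ℝ => 2 * C * M * max (h ^ (q₁ / 2)) (h ^ (q₂ - q₁ / 2)))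
      (𝓝 0) (𝓝 0) := by
    have := ((hrpow (q₁ / 2) (by positivity)).max (hrpow (q₂ - q₁ / 2) (by linarith))).const_mul
      (2 * C * M)
    simpa using this
  obtain ⟨h₂, hh₂, hball⟩ := Metric.eventually_nhds_iff.1
    ((hT1.eventually (gt_mem_nhds hε3)).and
      ((hrpow (q₁ / 2) (by positivity)).eventually (gt_mem_nhds hc0)))
  have key : ∀ t s : Time T, t ≤ s → dist t s < min h₁ (min h₂ x₀) →
      dist (snell PP (stopAt Y wp) t ω) (snell PP (stopAt Y wp) s ω) < ε := by
    intro t s hts hd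
    have hst : (t : ℝ) ≤ s := hts
    rw [Subtype.dist_eq, Real.dist_eq, abs_sub_comm, abs_of_nonneg (sub_nonneg.2 hst), lt_min_iff,
      lt_min_iff] at hd
    obtain ⟨hd1, hd2, hd3⟩ := hd
    obtain ⟨hb1, hb2⟩ := hball (y := (s : ℝ) - t)
      (by rwa [Real.dist_eq, sub_zero, abs_of_nonneg (sub_nonneg.2 hst)])
    have hosc : oscOn t s ω ≤ c / 2 := by
      refine Real.iSup_le ?_ (by positivity)
      rintro ⟨⟨r, r'⟩, h1, h2, h3⟩
      refine (hω r' r ?_).le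
      have e1 : (t : ℝ) ≤ r := h1
      have e2 : (r : ℝ) < r' := h2
      have e3 : (r' : ℝ) ≤ s := h3
      rw [abs_of_pos (sub_pos.2 e2)]
      linarith
    have hδ : deltaTS κ q₁ t s ω < x₀ := by
      have e : x₀ = (1 + κ) * (c + c) := by rw [hc]; field_simp; ring
      rw [e]
      unfold deltaTS
      gcongr
      linarith
    rw [Real.dist_eq]
    have := hY.abs_snell_sub_snell_le hne hP2 hP3 hP4 hρ₁.1 hB hϱm hBϱ hC hpow ω hts
    linarith [hx _ (sub_nonneg.2 hst) hd3, hx _ (hY.deltaTS_nonneg hts q₁ ω) hδ]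
  refine ⟨min h₁ (min h₂ x₀), by positivity, fun {t s} hd => ?_⟩
  rcases le_total t s with h | h
  · exact key t s h hd
  · rw [dist_comm]; exact key s t h (by rwa [dist_comm])

end SnellEnvelope

namespace SnellEnvelope

variable {d : ℕ} {T : ℝ}

/-! ### Discretization of stopping times -/

/-- The index of the first grid time after `τ`. -/
def gridIndex (n : ℕ) (τ : Time T) : ℕ := ⌈((n : ℝ) + 1) * τ⌉₊

theorem gridIndex_mem_range (n : ℕ) (τ : Time T) :
    gridIndex n τ ∈ Finset.range (⌈((n : ℝ) + 1) * T⌉₊ + 1) := by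
  rw [Finset.mem_range, Nat.lt_succ_iff]
  exact Nat.ceil_mono (mul_le_mul_of_nonneg_left τ.2.2 (by positivity))

theorem measurable_gridIndex (n : ℕ) : Measurable (gridIndex n : Time T → ℕ) :=
  Nat.measurable_ceil.comp (measurable_const.mul measurable_subtype_coe)

/-- On the cell `ν ≤ s`, so the path up to `s` determines `ν`; it also decides whether `γ` came
strictly before `ν`. -/
theorem gridIndex_inter_mem_filt {t : Time T} {ν γ : PathSpace d t → Time T}
    (hν : ν ∈ stoppingTimes d t) (hγ : γ ∈ stoppingTimes d t) (n k : ℕ) {s : Time T}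
    (hs : ∀ ω, gridIndex n (ν ω) = k → ν ω ≤ s) :
    MeasurableSet[filt d t s] {ω | gridIndex n (ν ω) = k ∧ ν ω ≤ γ ω} := by
  have hνm := stoppingTimes_measurable hν
  have hle : MeasurableSet {ω | ν ω ≤ γ ω} := measurableSet_le hνm (stoppingTimes_measurable hγ)
  have hk : MeasurableSet {ω | gridIndex n (ν ω) = k} :=
    (measurable_gridIndex n).comp hνm (measurableSet_singleton k)
  refine measurableSet_filt_of_stopped (hk.inter hle) fun ω => ?_
  have key : ∀ {ω ω' : PathSpace d t}, stopped s ω = stopped s ω' →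
      (gridIndex n (ν ω) = k ∧ ν ω ≤ γ ω) → gridIndex n (ν ω') = k ∧ ν ω' ≤ γ ω' := by
    rintro ω ω' e ⟨h1, h2⟩
    have hle := hs ω h1
    have h3 := stoppingTimes_eq_of_le hν e hle
    rw [h3]
    refine ⟨h1, not_lt.1 fun h4 => ?_⟩
    rw [stoppingTimes_eq_of_le hγ e.symm (h4.le.trans hle)] at h2
    exact h2.not_gt h4
  have e : stopped s ω = stopped s (stopped s ω) := by rw [stopped_stopped, min_self]
  exact ⟨key e, key e.symm⟩

open scoped Classical in
/-- The stopping time `γ`, postponed to the horizon unless `γ < ν`. -/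
theorem postpone_mem_stoppingTimes {t u : Time T} (hu : ∀ r : Time T, r ≤ u)
    {ν γ : PathSpace d t → Time T}
    (hν : ν ∈ stoppingTimes d t) (hγ : γ ∈ stoppingTimes d t) :
    (fun ω => if ν ω ≤ γ ω then u else γ ω) ∈ stoppingTimes d t := by
  refine mem_stoppingTimes (Measurable.ite (measurableSet_le (stoppingTimes_measurable hν)
    (stoppingTimes_measurable hγ)) measurable_const (stoppingTimes_measurable hγ))
    (fun ω => ?_) fun r _ ω => ?_
  · split_ifs
    · exact hu t
    · exact hγ.1 ω
  · rcases (hu r).eq_or_lt with rfl | hr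
    · exact iff_of_true (hu _) (hu _)
    have key : ∀ {ω ω' : PathSpace d t}, stopped r ω = stopped r ω' →
        (if ν ω ≤ γ ω then u else γ ω) ≤ r → (if ν ω' ≤ γ ω' then u else γ ω') ≤ r := by
      intro ω ω' e h
      split_ifs at h with h1
      · exact absurd h hr.not_ge
      · have h2 := stoppingTimes_eq_of_le hγ e h
        have h3 : ¬ ν ω' ≤ γ ω' := fun h4 => h1 (by
          rw [h2] at h4
          rwa [stoppingTimes_eq_of_le hν e.symm (h4.trans h)])
        rwa [if_neg h3, h2]
    have e : stopped r ω = stopped r (stopped r ω) := by rw [stopped_stopped, min_self]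
    exact ⟨key e, key e.symm⟩

variable [Fact (0 < T)]

/-- The time `k / (n + 1)`, capped at `T`. -/
def gridTime (T : ℝ) [hT : Fact (0 < T)] (n k : ℕ) : Time T :=
  ⟨min T (k / (n + 1)), le_min hT.out.le (by positivity), min_le_left _ _⟩

theorem le_gridTime (n : ℕ) (τ : Time T) : τ ≤ gridTime T n (gridIndex n τ) := by
  refine le_min τ.2.2 ?_
  rw [le_div_iff₀ (by positivity), mul_comm]
  exact Nat.le_ceil _

theorem gridTime_le (n : ℕ) (τ : Time T) :
    (gridTime T n (gridIndex n τ) : ℝ) ≤ τ + 1 / ((n : ℝ) + 1) := by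
  refine (min_le_right _ _).trans ?_
  rw [div_le_iff₀ (by positivity), add_mul, one_div_mul_cancel (by positivity), mul_comm]
  exact (Nat.ceil_lt_add_one (mul_nonneg (by positivity) τ.2.1)).le

theorem tendsto_gridTime (τ : Time T) :
    Tendsto (fun n => gridTime T n (gridIndex n τ)) atTop (𝓝 τ) := by
  rw [tendsto_subtype_rng]
  refine tendsto_of_tendsto_of_tendsto_of_le_of_le tendsto_const_nhds ?_
    (fun n => le_gridTime n τ) (fun n => gridTime_le n τ)
  simpa using tendsto_one_div_add_atTop_nhds_zero_nat.const_add (τ : ℝ)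

/-! ### The dynamic programming principle -/

variable {PP : ∀ t : Time T, Set (ProbabilityMeasure (PathSpace d t))}
  {Y : Time T → Omega d T → ℝ} {wp : Omega d T → Time T} {M : ℝ} {ρ ρ₁ : ℝ → ℝ} {κ : ℝ}

/-- A Carathéodory function, continuous in time and measurable in the path, is jointly measurable;
this makes `Z` at a random time measurable. -/
theorem IsPayoffPair.measurable_uncurry_snell (hY : IsPayoffPair Y wp M ρ κ)
    (hne : ∀ t, (PP t).Nonempty) (hP2 : HasMoveBounds PP) (hP3 : ShiftInvariant PP)
    (hP4 : WeaklyStableUnderPasting PP) :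
    Measurable (Function.uncurry (snell PP (stopAt Y wp))) :=
  measurable_uncurry_of_continuous_of_measurable
    (hY.continuous_snell_path hne hP2 hP3 hP4) fun t => (hY.continuous_snell hne hP2 t).measurable

theorem IsPayoffPair.integrable_shift_snell_comp (hY : IsPayoffPair Y wp M ρ κ)
    (hne : ∀ t, (PP t).Nonempty) (hP2 : HasMoveBounds PP) (hP3 : ShiftInvariant PP)
    (hP4 : WeaklyStableUnderPasting PP) {t : Time T} (ω : Omega d T)
    {τ : PathSpace d t → Time T} (hτ : Measurable τ) (P : ProbabilityMeasure (PathSpace d t)) :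
    Integrable (fun ω' => shift (snell PP (stopAt Y wp)) t ω (τ ω') ω')
      (P : Measure (PathSpace d t)) := by
  refine Integrable.of_bound (Measurable.aestronglyMeasurable ?_) M
    (ae_of_all _ fun _ => hY.abs_snell_le hne _ _)
  exact (hY.measurable_uncurry_snell hne hP2 hP3 hP4).comp
    (hτ.prodMk (measurable_concat_right (Time.zero_le t) ω))

theorem IsPayoffPair.tendsto_setIntegral_snell (hY : IsPayoffPair Y wp M ρ κ)
    (hne : ∀ t, (PP t).Nonempty) (hP2 : HasMoveBounds PP) (hP3 : ShiftInvariant PP)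
    (hP4 : WeaklyStableUnderPasting PP) {t : Time T} (ω : Omega d T)
    {τ : ℕ → PathSpace d t → Time T} {ν : PathSpace d t → Time T}
    (hτ : ∀ n, Measurable (τ n)) (P : ProbabilityMeasure (PathSpace d t))
    {S : Set (PathSpace d t)} (hS : MeasurableSet S)
    (hlim : ∀ ω' ∈ S, Tendsto (fun n => τ n ω') atTop (𝓝 (ν ω'))) :
    Tendsto (fun n => ∫ ω' in S, shift (snell PP (stopAt Y wp)) t ω (τ n ω') ω'
        ∂(P : Measure (PathSpace d t))) atTop
      (𝓝 (∫ ω' in S, shift (snell PP (stopAt Y wp)) t ω (ν ω') ω'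
        ∂(P : Measure (PathSpace d t)))) := by
  refine tendsto_integral_of_dominated_convergence (fun _ => M)
    (fun n => (hY.integrable_shift_snell_comp hne hP2 hP3 hP4 ω (hτ n) P).integrableOn.1)
    (integrable_const _) (fun n => ae_of_all _ fun _ => hY.abs_snell_le hne _ _) ?_
  refine (ae_restrict_iff' hS).2 (ae_of_all _ fun ω' h => ?_)
  exact ((hY.continuous_snell_path hne hP2 hP3 hP4 _).tendsto _).comp (hlim ω' h)

theorem IsPayoffPair.integrable_dppPayoff (hY : IsPayoffPair Y wp M ρ κ)
    (hne : ∀ t, (PP t).Nonempty) (hP2 : HasMoveBounds PP) (hP3 : ShiftInvariant PP)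
    (hP4 : WeaklyStableUnderPasting PP) {t : Time T} (ω : Omega d T)
    {γ ν : PathSpace d t → Time T} (hγ : Measurable γ) (hν : Measurable ν)
    (P : ProbabilityMeasure (PathSpace d t)) :
    Integrable (dppPayoff (stopAt Y wp) (snell PP (stopAt Y wp)) t ω γ ν)
      (P : Measure (PathSpace d t)) := by
  refine Integrable.of_bound (Measurable.aestronglyMeasurable ?_) M (ae_of_all _ fun ω' => ?_)
  · exact Measurable.ite (measurableSet_lt hγ hν) (hY.measurable_shift ω hγ)
      ((hY.measurable_uncurry_snell hne hP2 hP3 hP4).comp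
        (hν.prodMk (measurable_concat_right (Time.zero_le t) ω)))
  · unfold dppPayoff
    split_ifs
    · exact hY.abs_stopAt_le _ _
    · exact hY.abs_snell_le hne _ _

theorem IsPayoffPair.integral_dppPayoff (hY : IsPayoffPair Y wp M ρ κ)
    (hne : ∀ t, (PP t).Nonempty) (hP2 : HasMoveBounds PP) (hP3 : ShiftInvariant PP)
    (hP4 : WeaklyStableUnderPasting PP) {t : Time T} (ω : Omega d T)
    {γ ν : PathSpace d t → Time T} (hγ : Measurable γ) (hν : Measurable ν)
    (P : ProbabilityMeasure (PathSpace d t)) :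
    ∫ ω', dppPayoff (stopAt Y wp) (snell PP (stopAt Y wp)) t ω γ ν ω'
        ∂(P : Measure (PathSpace d t))
      = ∫ ω' in {ω' | ν ω' ≤ γ ω'}, shift (snell PP (stopAt Y wp)) t ω (ν ω') ω'
          ∂(P : Measure (PathSpace d t))
        + ∫ ω' in {ω' | ν ω' ≤ γ ω'}ᶜ, shift (stopAt Y wp) t ω (γ ω') ω'
          ∂(P : Measure (PathSpace d t)) := by
  have hS : MeasurableSet {ω' | ν ω' ≤ γ ω'} := measurableSet_le hν hγ
  rw [← integral_add_compl hS (hY.integrable_dppPayoff hne hP2 hP3 hP4 ω hγ hν P)]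
  congr 1
  · exact setIntegral_congr_fun hS fun ω' h => if_neg (not_lt.2 h)
  · exact setIntegral_congr_fun hS.compl fun ω' h =>
      if_pos (not_le.1 (show ¬ ν ω' ≤ γ ω' from h))

theorem IsPayoffPair.integral_dppPayoff_le (hY : IsPayoffPair Y wp M ρ κ)
    (hne : ∀ t, (PP t).Nonempty) (hP2 : HasMoveBounds PP) (hP3 : ShiftInvariant PP)
    (hP4 : WeaklyStableUnderPasting PP) {t : Time T} (ω : Omega d T)
    {γ ν : PathSpace d t → Time T} (hγ : γ ∈ stoppingTimes d t) (hν : ν ∈ stoppingTimes d t)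
    {P : ProbabilityMeasure (PathSpace d t)} (hP : P ∈ PP t) :
    ∫ ω', dppPayoff (stopAt Y wp) (snell PP (stopAt Y wp)) t ω γ ν ω'
        ∂(P : Measure (PathSpace d t)) ≤ snell PP (stopAt Y wp) t ω := by
  classical
  have hγm := stoppingTimes_measurable hγ
  have hνm := stoppingTimes_measurable hν
  rw [hY.integral_dppPayoff hne hP2 hP3 hP4 ω hγm hνm P]
  set S : Set (PathSpace d t) := {ω' | ν ω' ≤ γ ω'} with hSdef
  have hS : MeasurableSet S := measurableSet_le hνm hγm
  have hgrid : ∀ n, Measurable fun ω' : PathSpace d t => gridTime T n (gridIndex n (ν ω')) :=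
    fun n => (measurable_from_nat (f := gridTime T n)).comp ((measurable_gridIndex n).comp hνm)
  refine le_of_tendsto' ((hY.tendsto_setIntegral_snell hne hP2 hP3 hP4 ω hgrid P hS
    fun ω' _ => tendsto_gridTime (ν ω')).add_const _) fun n => ?_
  let u : Time T := ⟨T, (Fact.out : 0 < T).le, le_rfl⟩
  have hu : ∀ r : Time T, r ≤ u := fun r => r.2.2
  -- The maximum with `t` only serves indices whose cell is empty or whose grid time is `t`: on a
  -- nonempty cell the grid time is at least `ν ≥ t`.
  set s : ℕ → Time T := fun k => max t (gridTime T n k) with hs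
  set D : ℕ → Set (PathSpace d t) := fun k => {ω' | gridIndex n (ν ω') = k ∧ ν ω' ≤ γ ω'} with hD
  have hDs : ∀ k, ∀ ω' ∈ D k, gridTime T n (gridIndex n (ν ω')) = s k := fun k ω' h => by
    have h1 : gridIndex n (ν ω') = k := h.1
    rw [hs, ← h1]
    exact (max_eq_right ((hν.1 ω').trans (le_gridTime n _))).symm
  have hDm : ∀ k, MeasurableSet[filt d t (s k)] (D k) := fun k =>
    gridIndex_inter_mem_filt hν hγ n k fun ω' h =>
      (le_gridTime n _).trans (h ▸ le_max_right _ _)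
  have hDm' : ∀ k, MeasurableSet (D k) := fun k => (filt d t).le _ _ (hDm k)
  have hdisj : Pairwise fun i j => Disjoint (D i) (D j) := fun i j hij =>
    Set.disjoint_left.2 fun ω' h1 h2 => hij (h1.1.symm.trans h2.1)
  set I := Finset.range (⌈((n : ℝ) + 1) * T⌉₊ + 1) with hI
  have hU : (⋃ k ∈ I, D k) = S := by
    ext ω'
    rw [Set.mem_iUnion₂]
    exact ⟨fun ⟨k, _, h⟩ => h.2, fun h => ⟨_, gridIndex_mem_range n _, rfl, h⟩⟩
  -- Pasting at `s k` needs a stopping time that is at least `s k` on `D k`, whereas `γ` is only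
  -- known to exceed `ν`. Postponing it to the horizon on `{ν ≤ γ}` secures this and keeps the
  -- payoff on `{γ < ν}`.
  have main := hY.setIntegral_add_sum_le hne hP2 hP4 ω I (fun k => le_max_left _ _) hDm hdisj hP
    (postpone_mem_stoppingTimes hu hν hγ) fun k _ ω' h => by
      rw [if_pos h.2]; exact hu _
  rw [hU] at main
  have e1 : ∫ ω' in Sᶜ, shift (stopAt Y wp) t ω (if ν ω' ≤ γ ω' then u else γ ω') ω'
        ∂(P : Measure (PathSpace d t))
      = ∫ ω' in Sᶜ, shift (stopAt Y wp) t ω (γ ω') ω' ∂(P : Measure (PathSpace d t)) :=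
    setIntegral_congr_fun hS.compl fun ω' h => by
      have h' : ¬ ν ω' ≤ γ ω' := h
      simp only [if_neg h']
  have e2 : ∫ ω' in S, shift (snell PP (stopAt Y wp)) t ω (gridTime T n (gridIndex n (ν ω'))) ω'
        ∂(P : Measure (PathSpace d t))
      = ∑ k ∈ I, ∫ ω' in D k, shift (snell PP (stopAt Y wp)) t ω (s k) ω'
        ∂(P : Measure (PathSpace d t)) := by
    rw [← hU, integral_biUnion_finset I (fun k _ => hDm' k) (fun i _ j _ h => hdisj h) fun k _ =>
      (hY.integrable_shift_snell_comp hne hP2 hP3 hP4 ω (hgrid n) P).integrableOn]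
    refine Finset.sum_congr rfl fun k _ => setIntegral_congr_fun (hDm' k) fun ω' h => ?_
    simp only [hDs k ω' h]
  rw [e2, add_comm]
  exact e1 ▸ main

theorem IsPayoffPair.integral_shift_le_dppPayoff (hY : IsPayoffPair Y wp M ρ κ)
    (hne : ∀ t, (PP t).Nonempty) (hP2 : HasMoveBounds PP) (hP3 : ShiftInvariant PP)
    (hP4 : WeaklyStableUnderPasting PP) {t : Time T} (ω : Omega d T)
    {γ ν : PathSpace d t → Time T} (hγ : γ ∈ stoppingTimes d t) (hν : ν ∈ stoppingTimes d t)
    {P : ProbabilityMeasure (PathSpace d t)} (hP : P ∈ PP t) :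
    ∫ ω', shift (stopAt Y wp) t ω (γ ω') ω' ∂(P : Measure (PathSpace d t))
      ≤ ∫ ω', dppPayoff (stopAt Y wp) (snell PP (stopAt Y wp)) t ω γ ν ω'
        ∂(P : Measure (PathSpace d t)) := by
  have hγm := stoppingTimes_measurable hγ
  have hνm := stoppingTimes_measurable hν
  rw [hY.integral_dppPayoff hne hP2 hP3 hP4 ω hγm hνm P]
  set S : Set (PathSpace d t) := {ω' | ν ω' ≤ γ ω'} with hSdef
  have hS : MeasurableSet S := measurableSet_le hνm hγm
  have hXi := hY.integrable_shift ω hγm P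
  rw [← integral_add_compl hS hXi]
  refine add_le_add ?_ le_rfl
  -- The minimum with `γ` handles paths with `ν ≤ γ` whose grid time lies beyond `γ`: conditioning
  -- is impossible there, but `τ n = γ` and `Ŷ_γ ≤ Z_γ`. On `{ν ≤ γ}` these times still converge to
  -- `ν`.
  set τ : ℕ → PathSpace d t → Time T :=
    fun n ω' => min (γ ω') (gridTime T n (gridIndex n (ν ω'))) with hτ
  have hτm : ∀ n, Measurable (τ n) := fun n =>
    hγm.min ((measurable_from_nat (f := gridTime T n)).comp ((measurable_gridIndex n).comp hνm))
  refine ge_of_tendsto' (hY.tendsto_setIntegral_snell hne hP2 hP3 hP4 ω hτm P hS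
    (ν := ν) fun ω' h => ?_) fun n => ?_
  · have := (tendsto_const_nhds (x := γ ω')).min (tendsto_gridTime (ν ω'))
    rwa [min_eq_right (show ν ω' ≤ γ ω' from h)] at this
  set s : ℕ → Time T := fun k => max t (gridTime T n k) with hs
  set D : ℕ → Set (PathSpace d t) := fun k =>
    {ω' | gridIndex n (ν ω') = k ∧ ν ω' ≤ γ ω'} ∩ {ω' | s k ≤ γ ω'} with hD
  have hDs : ∀ k, ∀ ω', gridIndex n (ν ω') = k →
      gridTime T n (gridIndex n (ν ω')) = s k := fun k ω' h1 => by
    rw [hs, ← h1]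
    exact (max_eq_right ((hν.1 ω').trans (le_gridTime n _))).symm
  have hDm : ∀ k, MeasurableSet[filt d t (s k)] (D k) := fun k =>
    @MeasurableSet.inter _ (filt d t (s k)) _ _
      (gridIndex_inter_mem_filt hν hγ n k fun ω' h =>
        (le_gridTime n _).trans (h ▸ le_max_right _ _))
      (measurableSet_filt_of_stopped (hγm measurableSet_Ici) fun ω' => by
        have := stoppingTimes_lt_congr hγ (r := s k) (ω := ω') (ω' := stopped (s k) ω')
          (by rw [stopped_stopped, min_self])
        change s k ≤ γ ω' ↔ s k ≤ γ (stopped (s k) ω')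
        rw [← not_lt, ← not_lt, this])
  have hDm' : ∀ k, MeasurableSet (D k) := fun k => (filt d t).le _ _ (hDm k)
  have hdisj : Pairwise fun i j => Disjoint (D i) (D j) := fun i j hij =>
    Set.disjoint_left.2 fun ω' h1 h2 => hij (h1.1.1.symm.trans h2.1.1)
  set I := Finset.range (⌈((n : ℝ) + 1) * T⌉₊ + 1) with hI
  set U : Set (PathSpace d t) := ⋃ k ∈ I, D k with hU
  have hUm : MeasurableSet U := Finset.measurableSet_biUnion I fun k _ => hDm' k
  have hUS : U ⊆ S := Set.iUnion₂_subset fun k _ ω' h => h.1.2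
  have hZτ := hY.integrable_shift_snell_comp hne hP2 hP3 hP4 ω (hτm n) P
  rw [← integral_inter_add_sdiff hUm hXi.integrableOn,
    ← integral_inter_add_sdiff hUm hZτ.integrableOn, Set.inter_eq_right.2 hUS]
  refine add_le_add ?_ ?_
  · rw [hU, integral_biUnion_finset I (fun k _ => hDm' k) (fun i _ j _ h => hdisj h) fun k _ =>
        hXi.integrableOn, integral_biUnion_finset I (fun k _ => hDm' k)
        (fun i _ j _ h => hdisj h) fun k _ => hZτ.integrableOn]
    refine Finset.sum_le_sum fun k _ => ?_
    have e : ∫ ω' in D k, shift (snell PP (stopAt Y wp)) t ω (τ n ω') ω'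
          ∂(P : Measure (PathSpace d t))
        = ∫ ω' in D k, shift (snell PP (stopAt Y wp)) t ω (s k) ω'
          ∂(P : Measure (PathSpace d t)) :=
      setIntegral_congr_fun (hDm' k) fun ω' h => by
        have h1 : τ n ω' = s k := by
          rw [hτ]
          dsimp only
          rw [hDs k ω' h.1.1]
          exact min_eq_right h.2
        simp only [h1]
    rw [e]
    exact hY.setIntegral_shift_le hne hP2 hP3 (le_max_left _ _) ω hP hγ (hDm k) fun ω' h => h.2
  · refine setIntegral_mono_on hXi.integrableOn hZτ.integrableOn (hS.diff hUm) fun ω' h => ?_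
    have h1 : τ n ω' = γ ω' := by
      refine min_eq_left (not_lt.1 fun h2 => h.2 ?_)
      refine Set.mem_iUnion₂.2 ⟨_, gridIndex_mem_range n (ν ω'), ⟨rfl, h.1⟩, ?_⟩
      rw [hDs _ ω' rfl] at h2
      exact h2.le
    rw [h1]
    exact hY.stopAt_le_snell hne _ _

end SnellEnvelope

end

theorem proposition4p2 (d : ℕ) (hd : 0 < d) (T : ℝ) [Fact (0 < T)]
    (PP : ∀ t : Time T, Set (ProbabilityMeasure (PathSpace d t)))
    (hne : ∀ t, (PP t).Nonempty)
    (hP2 : HasMoveBounds PP) (hP3 : ShiftInvariant PP) (hP4 : WeaklyStableUnderPasting PP)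
    (Y : Time T → Omega d T → ℝ) (wp : Omega d T → Time T)
    (M : ℝ) (ρ : ℝ → ℝ) (κ : ℝ) (hY : IsPayoffPair Y wp M ρ κ)
    (Z : Time T → Omega d T → ℝ) (hZ : Z = snell PP (stopAt Y wp)) :
    -- the dynamic programming principle
    (∀ (t : Time T) (ω : Omega d T), ∀ ν ∈ stoppingTimes d t,
      (∀ P ∈ PP t, ∀ γ ∈ stoppingTimes d t,
        Integrable (dppPayoff (stopAt Y wp) Z t ω γ ν) (P : Measure (PathSpace d t))) ∧
      IsLUB {x : ℝ | ∃ P ∈ PP t, ∃ γ ∈ stoppingTimes d t,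
        x = ∫ ω', dppPayoff (stopAt Y wp) Z t ω γ ν ω' ∂(P : Measure (PathSpace d t))} (Z t ω)) ∧
    -- `Z` is adapted, bounded by `M`, and has continuous paths
    (∀ t : Time T, Measurable[filt d (Time.zero T) t] (Z t)) ∧
    (∀ (t : Time T) (ω : Omega d T), |Z t ω| ≤ M) ∧
    (∀ ω : Omega d T, Continuous fun t : Time T => Z t ω) ∧
    -- the path continuity estimate
    (∀ ρ₁ ∈ modulusClass, MoveBound PP ρ ρ₁ → ∀ ρ₂ ∈ modulusClass, MoveBound PP ρ₁ ρ₂ →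
      ∀ ϱ ∈ modulusClass, MoveBound PP (fun x => x) ϱ →
      ∀ C q₁ q₂ : ℝ, 0 < C → 0 < q₁ → q₁ ≤ q₂ → PowerBound ϱ C q₁ q₂ →
      ∀ (ω : Omega d T) (t s : Time T), t ≤ s →
        |Z t ω - Z s ω| ≤
          2 * C * M * max (((s : ℝ) - t) ^ (q₁ / 2)) (((s : ℝ) - t) ^ (q₂ - q₁ / 2))
            + ρ₁ ((s : ℝ) - t)
            + 2 * max (ρ₁ (deltaTS κ q₁ t s ω)) (ρ₂ (deltaTS κ q₁ t s ω))) := by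
  subst hZ
  refine ⟨fun t ω ν hν => ⟨fun P _ γ hγ => ?_, ?_, ?_⟩, fun t => ?_, fun t ω => ?_, fun ω => ?_, ?_⟩
  · exact hY.integrable_dppPayoff hne hP2 hP3 hP4 ω (stoppingTimes_measurable hγ)
      (stoppingTimes_measurable hν) P
  · rintro _ ⟨P, hP, γ, hγ, rfl⟩
    exact hY.integral_dppPayoff_le hne hP2 hP3 hP4 ω hγ hν hP
  · exact fun b hb => snell_le hne fun P hP γ hγ =>
      (hY.integral_shift_le_dppPayoff hne hP2 hP3 hP4 ω hγ hν hP).trans (hb ⟨P, hP, γ, hγ, rfl⟩)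
  · exact hY.measurable_snell_filt hne hP2 t
  · exact hY.abs_snell_le hne t ω
  · exact hY.continuous_snell_path hne hP2 hP3 hP4 ω
  · intro ρ₁ hρ₁ hB ρ₂ _ _ ϱ hϱ hBϱ C q₁ q₂ hC _ _ hpow ω t s hts
    -- The bound obtained has a single `ρ₁(δ)` as its last term, which is nonnegative and hence at
    -- most twice the maximum.
    refine (hY.abs_snell_sub_snell_le hne hP2 hP3 hP4 hρ₁.1 hB hϱ.1 hBϱ hC hpow ω hts).trans ?_
    have h1 := hρ₁.1.1 _ (hY.deltaTS_nonneg hts q₁ ω)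
    have h2 := le_max_left (ρ₁ (deltaTS κ q₁ t s ω)) (ρ₂ (deltaTS κ q₁ t s ω))
    linarith
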